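/- Let $V_\omega$ be a jointly measurable real random potential on $\mathbb{R}$ and let $I_n=(n-1,n]$. Assume $\sup_{n\ge 1}\mathbb{E}\big[\int_{I_n}|V(x)|\,dx\big]<\infty$. For $L\in\mathbb{N}$, $L\ge 1$, let $H_L^{\pm}=-\frac{d^2}{dx^2}+V_\omega$ on $L^2([0,L])$ with periodic ($+$) or antiperiodic ($-$) boundary conditions, defined almost surely through its quadratic form on $H^1$ functions satisfying the boundary condition. Let $(\varphi_{j,L}^\pm)_j$ be a complete orthonormal system of eigenfunctions, jointly measurable in $(x,\omega)$, with eigenvalues $E_{j,L}^\pm$. Let $\Phi_{j,L}^{\pm}(n)=\big(\int_{I_n}|\varphi_{j,L}^\pm|^2\big)^{1/2}$. Let $J\subset\mathbb{R}$ be a Borel set on which the following localization hypothesis holds: there are $C,\ell\in(0,\infty)$ and $\xi\in(0,1]$ such that for both boundary conditions, all $L\in\mathbb{N}$ and all $1\le n,m\le L$, $$\mathbb{E}\Big[\sum_{j:\,E_{j,L}^\pm\in J}\Phi_{j,L}^\pm(n)\,\Phi_{j,L}^\pm(m)\Big]\le C\exp\big(-\operatorname{dist}(n,m)^\xi/\ell^\xi\big),$$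 where $\operatorname{dist}(n,m)=\min\{|n-m|,L-|n-m|\}$. Assume in addition that for some $p>2$, with $P_J(H_L^\pm)$ the spectral projection of $H_L^\pm$ onto $J$, $$\sup_{L\ge1,\ 1\le n\le L,\ \pm}\ \mathbb{E}\big[\big(\operatorname{tr} 1_{I_n}P_J(H_L^\pm)\big)^p\big]<\infty .$$ For every $L$ and $\omega$ choose a particle number $N=N_{L,\omega}$ and $N$ distinct indices $j_1,\dots,j_N$ (which may depend on $L$ and $\omega$) such that $E^{\sharp}_{j_\alpha,L}\in J$ for all $\alpha$, where $\sharp=(-1)^{N+1}$. Let $$\Psi(x_1,\dots,x_N)=\frac1{\sqrt{N!}}\det\big(\varphi^{\sharp}_{j_\alpha,L}(x_\beta)\big)_{\alpha,\beta=1}^N\prod_{1\le i<k\le N}\operatorname{sign}(x_i-x_k)$$ be the corresponding eigenstate of the Tonks--Girardeau gas on the ring of length $L$, and let $\|\gamma_\Psi\|$ be the operator norm on $L^2([0,L])$ of the reduced one-particle density matrix, i.e. of the integral operator with kernel $\gamma_\Psi(x,y)=N\int_{[0,L]^{N-1}}\Psi(x,x_2,\dots,x_N)\overline{\Psi(y,x_2,\dots,x_N)}\,dx_2\cdots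 dx_N$ (with $\gamma_\Psi=0$ if $N=0$). Then, for every $r$ with $2/p<r\le1$, almost surely $$\lim_{L\to\infty}\frac{\|\gamma_\Psi\|}{L^r}=0 .$$ In particular there is no Bose--Einstein condensation: almost surely, if $N/L\to\rho$ as $L\to\infty$ for some $\rho\in(0,\infty)$, then $\|\gamma_\Psi\|/N\to0$. -/

import Mathlib

open MeasureTheory Set Filter
open scoped ENNReal NNReal Topology ComplexConjugate

namespace TonksGirardeau

noncomputable section

/-- The unit interval `I_n = (n - 1, n]`. -/
def cell (n : ℕ) : Set ℝ := Ioc ((n : ℝ) - 1) n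

/-- Lebesgue measure on the ring of length `L`. -/
def ringMeasure (L : ℕ) : Measure ℝ := volume.restrict (Ioc (0 : ℝ) L)

/-- The one-particle Hilbert space `L²([0, L])`. -/
abbrev L2 (L : ℕ) : Type := Lp ℂ 2 (ringMeasure L)

/-- `f ∈ H¹([0, L])` with weak derivative `g` and `f(L) = s f(0)`, where `s = 1` stands for
periodic and `s = -1` for antiperiodic boundary conditions; `f` is the absolutely continuous
representative. -/
structure IsSobolev (L : ℕ) (s : ℤˣ) (f g : ℝ → ℂ) : Prop where
  memLp : MemLp g 2 (ringMeasure L)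
  eq_integral : ∀ x ∈ Icc (0 : ℝ) L, f x = f 0 + ∫ t in (0 : ℝ)..x, g t
  boundary : f L = ((s : ℤ) : ℂ) * f 0

/-- `f` satisfies `H f = E f`, where `H = - d²/dx² + V` on `L²([0, L])` with boundary condition
`s` is the operator defined by its quadratic form on the Sobolev space `H¹` with that boundary
condition. -/
def IsEigenfunction (V : ℝ → ℝ) (L : ℕ) (s : ℤˣ) (E : ℝ) (f : ℝ → ℂ) : Prop :=
  ∃ g : ℝ → ℂ, IsSobolev L s f g ∧ ∀ u v : ℝ → ℂ, IsSobolev L s u v →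
    (∫ x in (0 : ℝ)..L, conj (v x) * g x) + (∫ x in (0 : ℝ)..L, (V x : ℂ) * (conj (u x) * f x))
      = (E : ℂ) * ∫ x in (0 : ℝ)..L, conj (u x) * f x

/-- `(f j)` is a complete orthonormal system in `L²([0, L])` of eigenfunctions of `H`, with
eigenvalues `(E j)` (repeated according to multiplicity, in any order). -/
structure IsEigenbasis (V : ℝ → ℝ) (L : ℕ) (s : ℤˣ) (E : ℕ → ℝ) (f : ℕ → ℝ → ℂ) : Prop where
  eigen : ∀ j, IsEigenfunction V L s (E j) (f j)
  orthonormal : ∀ i j, ∫ x in (0 : ℝ)..L, conj (f i x) * f j x = if i = j then 1 else 0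
  complete : ∀ h : ℝ → ℂ, MemLp h 2 (ringMeasure L) →
    (∀ j, ∫ x in (0 : ℝ)..L, conj (f j x) * h x = 0) → h =ᵐ[ringMeasure L] 0

/-- `Φ(n) = (∫_{I_n} |f|²)^{1/2}`. -/
def cellNorm (f : ℝ → ℂ) (n : ℕ) : ℝ≥0∞ := (∫⁻ x in cell n, ‖f x‖ₑ ^ 2) ^ (1 / 2 : ℝ)

open Classical in
/-- The eigenfunction correlator `Q(n, m; J) = ∑_{j : E_j ∈ J} Φ_j(n) Φ_j(m)`. -/
def correlator (J : Set ℝ) (E : ℕ → ℝ) (f : ℕ → ℝ → ℂ) (n m : ℕ) : ℝ≥0∞ :=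
  ∑' j, if E j ∈ J then cellNorm (f j) n * cellNorm (f j) m else 0

/-- Distance of `n, m ∈ {1, …, L}` on the torus of length `L`. -/
def torusDist (L n m : ℕ) : ℝ := min |(n : ℝ) - m| (L - |(n : ℝ) - m|)

/-- The localization hypothesis on the energy regime `J`: (sub-)exponential decay of the averaged
eigenfunction correlator, for both boundary conditions and uniformly in the length of the ring. -/
def EigenfunctionCorrelatorLocalization {Ω : Type*} [MeasurableSpace Ω] (P : Measure Ω)
    (J : Set ℝ) (E : ℤˣ → ℕ → ℕ → Ω → ℝ) (φ : ℤˣ → ℕ → ℕ → Ω → ℝ → ℂ) : Prop :=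
  ∃ C ℓ ξ : ℝ, 0 < C ∧ 0 < ℓ ∧ 0 < ξ ∧ ξ ≤ 1 ∧
    ∀ (s : ℤˣ) (L n m : ℕ), 1 ≤ n → n ≤ L → 1 ≤ m → m ≤ L →
      ∫⁻ ω, correlator J (fun j => E s L j ω) (fun j => φ s L j ω) n m ∂P
        ≤ ENNReal.ofReal (C * Real.exp (-(torusDist L n m ^ ξ / ℓ ^ ξ)))

/-- The spectral subspace of `H` for `J`: as `H` has discrete spectrum, it is the closed span of
the eigenfunctions with eigenvalue in `J`. -/
def spectralSubspace (V : ℝ → ℝ) (L : ℕ) (s : ℤˣ) (J : Set ℝ) : Submodule ℂ (L2 L) :=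
  (Submodule.span ℂ {u : L2 L | ∃ E ∈ J, ∃ f : ℝ → ℂ,
    IsEigenfunction V L s E f ∧ u =ᵐ[ringMeasure L] f}).topologicalClosure

/-- The spectral projection `P_J(H)`. -/
def spectralProjection (V : ℝ → ℝ) (L : ℕ) (s : ℤˣ) (J : Set ℝ) : L2 L →L[ℂ] L2 L :=
  haveI : CompleteSpace (spectralSubspace V L s J) :=
    (Submodule.isClosed_topologicalClosure _).completeSpace_coe
  (spectralSubspace V L s J).starProjection

/-- The local particle number `tr 1_{I_n} P_J(H) = tr P_J(H) 1_{I_n} P_J(H)`. The diagonal matrix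
elements of this nonnegative operator are `⟨b, P_J 1_{I_n} P_J b⟩ = ∫_{I_n} |P_J b|²`, and their
sum is the same for every orthonormal basis, so that the supremum is over equal numbers. -/
def localNumber (V : ℝ → ℝ) (L : ℕ) (s : ℤˣ) (J : Set ℝ) (n : ℕ) : ℝ≥0∞ :=
  ⨆ b : HilbertBasis ℕ ℂ (L2 L),
    ∑' i, ∫⁻ x in cell n, ‖spectralProjection V L s J (b i) x‖ₑ ^ 2 ∂(ringMeasure L)

/-- The boundary condition `♯_N = (-1)^{N+1}`: periodic for odd, antiperiodic for even `N`. -/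
def boundarySign (N : ℕ) : ℤˣ := (-1) ^ (N + 1)

/-- The bosonic wave function
`Ψ(x_1, …, x_N) = (N!)^{-1/2} det (f_α(x_β)) ∏_{i < k} sign (x_i - x_k)`. -/
def bosonState {N : ℕ} (f : Fin N → ℝ → ℂ) (x : Fin N → ℝ) : ℂ :=
  ((1 / Real.sqrt (N.factorial) : ℝ) : ℂ) * (Matrix.of fun α β => f α (x β)).det *
    ∏ i, ∏ k ∈ Finset.Ioi i, ((Real.sign (x i - x k) : ℝ) : ℂ)

/-- The kernel
`γ_Ψ(x, y) = N ∫ Ψ(x, x_2, …, x_N) conj Ψ(y, x_2, …, x_N) dx_2 … dx_N` of the reduced one-particle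
density matrix, the integral being over `[0, L]^{N-1}`. -/
def reducedDensity (L : ℕ) : {N : ℕ} → ((Fin N → ℝ) → ℂ) → ℝ → ℝ → ℂ
  | 0, _, _, _ => 0
  | N + 1, Ψ, x, y => ((N + 1 : ℕ) : ℂ) *
      ∫ z in Set.pi univ fun _ : Fin N => Ioc (0 : ℝ) L,
        Ψ (Fin.cons x z) * conj (Ψ (Fin.cons y z))

/-- The operator norm on `L²([0, L])` of the integral operator with kernel `k`. -/
def kernelNorm (L : ℕ) (k : ℝ → ℝ → ℂ) : ℝ≥0∞ :=
  ⨆ f : L2 L, ⨆ _ : ‖f‖ ≤ 1,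
    eLpNorm (fun x => ∫ y, k x y * f y ∂(ringMeasure L)) 2 (ringMeasure L)

end

end TonksGirardeau

/-! Fix a ring and orthonormal functions `f a`. In the product `Ψ(x, z) conj Ψ(y, z)` the signs
among the integrated particles square to one, and each particle at `t` contributes only the weight
`w(t) = sign(x - t) sign(y - t)`, which is -1 between `x` and `y` and +1 outside. Andréief's
identity then gives `γ(x, y) = ∑ f_a(x) conj f_b(y) adj(M)_{ba}` with `M_{ab} = ∫ f_a w conj f_b`.

Suppose the functions are localized at scale `D` and `x`, `y` are at least `4D` apart. A function
centered away from both points sees a constant weight, so orthogonality makes its matrix elements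
with the functions centered near `x` almost zero; a function centered near `y` has almost no overlap
with them. Hence `M` almost decouples the indices centered near `x` from the others. A minor that
deletes a row of that set and a column outside it would vanish under exact decoupling, and
Hadamard's inequality makes minors Lipschitz in the entries, so these entries of the adjugate are
tiny. The remaining terms are tiny because `f_a` is small at `x` or `f_b` is small at `y`. Thus `γ`
is negligible far from the diagonal, while near it Cauchy--Schwarz bounds its blocks by the local
particle numbers. A Schur test yields `‖γ‖ ≲ D · (maximal local number)`, up to a negligible term.

Borel--Cantelli supplies the input: for `q > 2 / p` the local numbers are almost surely at most `L ^
q`, and the correlator at distance `D ≈ L ^ η` is below `L ^ (-11)`. So `‖γ‖ ≲ L ^ (η + q)`, and `η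
+ q < r` can be arranged. Both estimates control sums over all eigenvalues in `J`, hence every
selection of eigenstates at once. -/

namespace TonksGirardeau

/-! ### Hadamard's inequality and the Lipschitz continuity of determinants. -/

section Hadamard

variable {n : Type*} [Fintype n] [DecidableEq n]

open scoped ComplexOrder in
/-- A normalized form of Hadamard's inequality. -/
theorem norm_det_le_one_of_row (X : Matrix n n ℂ) (h : ∀ i, ∑ j, ‖X i j‖ ^ 2 ≤ 1) :
    ‖X.det‖ ≤ 1 := by
  have hpsd : (X * X.conjTranspose).PosSemidef := Matrix.posSemidef_self_mul_conjTranspose X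
  have hH := hpsd.isHermitian
  have hdiag : ∀ i, (X * X.conjTranspose) i i = ((∑ j, ‖X i j‖ ^ 2 : ℝ) : ℂ) := by
    intro i
    rw [Matrix.mul_apply]
    push_cast
    refine Finset.sum_congr rfl fun j _ => ?_
    rw [Matrix.conjTranspose_apply, ← Complex.mul_conj']
    rfl
  have htr : ∑ i, hH.eigenvalues i ≤ Fintype.card n := by
    have h1 := hH.trace_eq_sum_eigenvalues
    simp only [Matrix.trace, Matrix.diag_apply, hdiag] at h1
    have h2 : ∑ i, ∑ j, ‖X i j‖ ^ 2 = ∑ i, hH.eigenvalues i := by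
      apply Complex.ofReal_injective
      rw [Complex.ofReal_sum, Complex.ofReal_sum]
      exact h1
    rw [← h2]
    calc ∑ i, ∑ j, ‖X i j‖ ^ 2 ≤ ∑ _i : n, (1 : ℝ) := Finset.sum_le_sum fun i _ => h i
      _ = Fintype.card n := by simp
  have hdet : ‖X.det‖ ^ 2 = ∏ i, hH.eigenvalues i := by
    have h1 := hH.det_eq_prod_eigenvalues
    rw [Matrix.det_mul, Matrix.det_conjTranspose] at h1
    have h2 : X.det * star X.det = ((‖X.det‖ ^ 2 : ℝ) : ℂ) := by
      push_cast
      exact Complex.mul_conj' _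
    rw [h2] at h1
    apply Complex.ofReal_injective
    rw [Complex.ofReal_prod]
    exact h1
  -- This replaces the inequality of arithmetic and geometric means: `λ ≤ exp (λ - 1)`, and `∑ (λ -
  -- 1) ≤ 0` by the trace bound.
  have hprod : ∏ i, hH.eigenvalues i ≤ 1 := by
    calc ∏ i, hH.eigenvalues i ≤ ∏ i, Real.exp (hH.eigenvalues i - 1) := by
          refine Finset.prod_le_prod (fun i _ => hpsd.eigenvalues_nonneg i) fun i _ => ?_
          linarith [Real.add_one_le_exp (hH.eigenvalues i - 1)]
      _ = Real.exp (∑ i, (hH.eigenvalues i - 1)) := (Real.exp_sum _ _).symm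
      _ ≤ 1 := by
          rw [Real.exp_le_one_iff, Finset.sum_sub_distrib]
          simp
          linarith
  rw [← hdet] at hprod
  exact (sq_le_one_iff₀ (norm_nonneg _)).1 hprod

/-- The determinant as a multilinear function of rows in Euclidean space. -/
noncomputable def detEuclidean (n : Type*) [Fintype n] [DecidableEq n] :
    MultilinearMap ℂ (fun _ : n => EuclideanSpace ℂ n) ℂ :=
  (Matrix.detRowAlternating (R := ℂ) (n := n)).toMultilinearMap.compLinearMap
    fun _ => (WithLp.linearEquiv 2 ℂ (n → ℂ)).toLinearMap

theorem detEuclidean_apply (m : n → EuclideanSpace ℂ n) :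
    detEuclidean n m = (Matrix.of fun i j => m i j).det := rfl

/-- Hadamard's inequality. -/
theorem norm_detEuclidean_le (m : n → EuclideanSpace ℂ n) :
    ‖detEuclidean n m‖ ≤ ∏ i, ‖m i‖ := by
  by_cases h0 : ∃ i, m i = 0
  · obtain ⟨i, hi⟩ := h0
    rw [(detEuclidean n).map_coord_zero i hi, norm_zero]
    positivity
  push Not at h0
  have hm : m = fun i => (‖m i‖ : ℂ) • ((‖m i‖⁻¹ : ℂ) • m i) := by
    funext i
    rw [smul_smul, mul_inv_cancel₀, one_smul]
    exact_mod_cast norm_ne_zero_iff.2 (h0 i)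
  have hunit : ‖detEuclidean n fun i => (‖m i‖⁻¹ : ℂ) • m i‖ ≤ 1 := by
    rw [detEuclidean_apply]
    refine norm_det_le_one_of_row _ fun i => ?_
    have h1 : ‖(‖m i‖⁻¹ : ℂ) • m i‖ = 1 := by
      rw [norm_smul, norm_inv, Complex.norm_real, norm_norm,
        inv_mul_cancel₀ (norm_ne_zero_iff.2 (h0 i))]
    have h2 := EuclideanSpace.norm_sq_eq ((‖m i‖⁻¹ : ℂ) • m i)
    rw [h1] at h2
    simp only [Matrix.of_apply]
    rw [← h2]
    norm_num
  conv_lhs => rw [hm]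
  rw [(detEuclidean n).map_smul_univ, norm_smul, norm_prod]
  simp only [Complex.norm_real, norm_norm]
  exact mul_le_of_le_one_right (by positivity) hunit

/-- Lipschitz bound for the determinant on matrices with rows of norm at most one. -/
theorem norm_det_sub_det_le (X Y : Matrix n n ℂ) (hX : ∀ i, ∑ j, ‖X i j‖ ^ 2 ≤ 1)
    (hY : ∀ i, ∑ j, ‖Y i j‖ ^ 2 ≤ 1) {ε : ℝ} (hε : 0 ≤ ε)
    (hXY : ∀ i j, ‖X i j - Y i j‖ ≤ ε) :
    ‖X.det - Y.det‖ ≤ (Fintype.card n : ℝ) ^ 2 * ε := by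
  set x : n → EuclideanSpace ℂ n := fun i => WithLp.toLp 2 (X i)
  set y : n → EuclideanSpace ℂ n := fun i => WithLp.toLp 2 (Y i)
  -- Replacing one row at a time costs one factor `card n`; the second one comes from bounding the
  -- `ℓ²` norm of a row difference by its `ℓ¹` norm.
  have hb := (detEuclidean n).norm_image_sub_le_of_bound (C := 1) zero_le_one
    (fun m => by rw [one_mul]; exact norm_detEuclidean_le m) x y
  have hx : ‖x‖ ≤ 1 := by
    refine (pi_norm_le_iff_of_nonneg zero_le_one).2 fun i => ?_
    rw [EuclideanSpace.norm_eq]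
    exact Real.sqrt_le_one.2 (hX i)
  have hy : ‖y‖ ≤ 1 := by
    refine (pi_norm_le_iff_of_nonneg zero_le_one).2 fun i => ?_
    rw [EuclideanSpace.norm_eq]
    exact Real.sqrt_le_one.2 (hY i)
  have hxy : ‖x - y‖ ≤ Fintype.card n * ε := by
    refine (pi_norm_le_iff_of_nonneg (by positivity)).2 fun i => ?_
    calc ‖(x - y) i‖ ≤ ∑ j, ‖X i j - Y i j‖ := by
          rw [EuclideanSpace.norm_eq]
          refine Real.sqrt_le_iff.2 ⟨by positivity, ?_⟩
          exact Finset.sum_sq_le_sq_sum_of_nonneg fun j _ => norm_nonneg _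
      _ ≤ ∑ _j : n, ε := Finset.sum_le_sum fun j _ => hXY i j
      _ = Fintype.card n * ε := by simp
  calc ‖X.det - Y.det‖ = ‖detEuclidean n x - detEuclidean n y‖ := rfl
    _ ≤ 1 * Fintype.card n * max ‖x‖ ‖y‖ ^ (Fintype.card n - 1) * ‖x - y‖ := hb
    _ ≤ 1 * Fintype.card n * 1 * (Fintype.card n * ε) := by
        gcongr
        exact pow_le_one₀ (le_max_of_le_left (norm_nonneg _)) (max_le hx hy)
    _ = (Fintype.card n : ℝ) ^ 2 * ε := by ring

end Hadamard

/-! ### Minors of almost decoupled matrices. -/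

/-- If the rows outside `A` vanish on the columns in `A`, a minor that deletes a row in `A` and a
column outside `A` vanishes. -/
theorem det_minor_eq_zero {k : ℕ} (X : Matrix (Fin (k + 1)) (Fin (k + 1)) ℂ)
    (A : Finset (Fin (k + 1))) {a b : Fin (k + 1)} (ha : a ∈ A) (hb : b ∉ A)
    (hX : ∀ i j, i ∉ A → j ∈ A → X i j = 0) :
    (X.submatrix a.succAbove b.succAbove).det = 0 := by
  rw [Matrix.det_apply]
  refine Finset.sum_eq_zero fun σ _ => ?_
  suffices h : ∃ j, b.succAbove j ∈ A ∧ a.succAbove (σ j) ∉ A by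
    obtain ⟨j, h1, h2⟩ := h
    rw [Finset.prod_eq_zero (Finset.mem_univ j), smul_zero]
    exact hX _ _ h2 h1
  -- Pigeonhole: since `b ∉ A`, all columns in `A` survive, but only `A.card - 1` rows in `A` do, so
  -- `σ` cannot map the former injectively into the latter.
  by_contra! hcon
  have hcard : (A.erase a).card < A.card := Finset.card_erase_lt_of_mem ha
  have hne : ∀ i ∈ A, i ≠ b := fun i hi h => hb (h ▸ hi)
  -- `g` is `σ` transported to the original indices; its value at `b` is arbitrary, because `b ∉ A`.
  set g : Fin (k + 1) → Fin (k + 1) := fun i =>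
    if h : i = b then a else a.succAbove (σ ((finSuccAboveEquiv b).symm ⟨i, h⟩))
  have hg : ∀ j, g (b.succAbove j) = a.succAbove (σ j) := by
    intro j
    have : b.succAbove j ≠ b := Fin.succAbove_ne b j
    simp only [g, dif_neg this]
    congr 2
    rw [Equiv.symm_apply_eq]
    rfl
  have hmaps : ∀ i ∈ A, g i ∈ A.erase a := by
    intro i hi
    obtain ⟨j, rfl⟩ := Fin.exists_succAbove_eq (hne i hi)
    rw [hg]
    exact Finset.mem_erase.2 ⟨Fin.succAbove_ne _ _, hcon j hi⟩
  obtain ⟨i, hi, i', hi', hii, hgi⟩ := Finset.exists_ne_map_eq_of_card_lt_of_maps_to hcard hmaps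
  obtain ⟨j, rfl⟩ := Fin.exists_succAbove_eq (hne i hi)
  obtain ⟨j', rfl⟩ := Fin.exists_succAbove_eq (hne i' hi')
  rw [hg, hg] at hgi
  exact hii (congrArg _ (σ.injective (Fin.succAbove_right_injective hgi)))

theorem sum_norm_sq_submatrix_le {k : ℕ} {X : Matrix (Fin (k + 1)) (Fin (k + 1)) ℂ}
    (hX : ∀ i, ∑ j, ‖X i j‖ ^ 2 ≤ 1) (a b : Fin (k + 1)) (i : Fin k) :
    ∑ j, ‖X.submatrix a.succAbove b.succAbove i j‖ ^ 2 ≤ 1 := by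
  refine le_trans ?_ (hX (a.succAbove i))
  rw [Fin.sum_univ_succAbove _ b]
  exact le_add_of_nonneg_left (by positivity)

theorem norm_adjugate_le_one {k : ℕ} {X : Matrix (Fin (k + 1)) (Fin (k + 1)) ℂ}
    (hX : ∀ i, ∑ j, ‖X i j‖ ^ 2 ≤ 1) (a b : Fin (k + 1)) : ‖X.adjugate b a‖ ≤ 1 := by
  rw [Matrix.adjugate_fin_succ_eq_det_submatrix, norm_mul, norm_pow, norm_neg, norm_one, one_pow,
    one_mul]
  exact norm_det_le_one_of_row _ (sum_norm_sq_submatrix_le hX a b)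

/-- Entries of the adjugate that couple two almost decoupled sets of indices are small. -/
theorem norm_adjugate_le_of_decoupled {k : ℕ} {X : Matrix (Fin (k + 1)) (Fin (k + 1)) ℂ}
    (hX : ∀ i, ∑ j, ‖X i j‖ ^ 2 ≤ 1) (A : Finset (Fin (k + 1))) {ε : ℝ} (hε : 0 ≤ ε)
    (hA : ∀ i j, i ∉ A → j ∈ A → ‖X i j‖ ≤ ε) {a b : Fin (k + 1)} (ha : a ∈ A) (hb : b ∉ A) :
    ‖X.adjugate b a‖ ≤ (k : ℝ) ^ 2 * ε := by
  classical
  -- Deleting the small coupling block moves every entry by at most `ε` and does not lengthen rows,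
  -- so the Lipschitz bound compares the minor with one that vanishes.
  set Y : Matrix (Fin (k + 1)) (Fin (k + 1)) ℂ :=
    Matrix.of fun i j => if i ∉ A ∧ j ∈ A then 0 else X i j
  have hYX : ∀ i j, ‖Y i j‖ ≤ ‖X i j‖ := by
    intro i j
    simp only [Y, Matrix.of_apply]
    split_ifs <;> simp
  have hY : ∀ i, ∑ j, ‖Y i j‖ ^ 2 ≤ 1 := fun i =>
    (Finset.sum_le_sum fun j _ => pow_le_pow_left₀ (norm_nonneg _) (hYX i j) 2).trans (hX i)
  have hY0 := det_minor_eq_zero Y A ha hb fun i j hi hj => by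
    simp only [Y, Matrix.of_apply, if_pos (And.intro hi hj)]
  have hdiff := norm_det_sub_det_le _ _ (sum_norm_sq_submatrix_le hX a b)
    (sum_norm_sq_submatrix_le hY a b) hε fun i j => by
      simp only [Matrix.submatrix_apply, Y, Matrix.of_apply]
      split_ifs with h
      · rw [sub_zero]
        exact hA _ _ h.1 h.2
      · rw [sub_self, norm_zero]
        exact hε
  rw [hY0, sub_zero, Fintype.card_fin] at hdiff
  rwa [Matrix.adjugate_fin_succ_eq_det_submatrix, norm_mul, norm_pow, norm_neg, norm_one, one_pow,
    one_mul]

/-! ### Andréief's identity and integrals of products of Slater determinants. -/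

section Andreief

variable {α : Type*}

theorem det_mul_det_eq_sum {k : ℕ} (f g : Fin k → α → ℂ) (z : Fin k → α) :
    (Matrix.of fun i j => f i (z j)).det * (Matrix.of fun i j => g i (z j)).det =
      ∑ τ : Equiv.Perm (Fin k), ∑ σ : Equiv.Perm (Fin k),
        (((Equiv.Perm.sign σ : ℤ) : ℂ) * ((Equiv.Perm.sign τ : ℤ) : ℂ)) *
          ∏ j, (f (σ j) (z j) * g (τ j) (z j)) := by
  rw [Matrix.det_apply', Matrix.det_apply', Finset.sum_mul_sum, Finset.sum_comm]
  refine Finset.sum_congr rfl fun τ _ => Finset.sum_congr rfl fun σ _ => ?_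
  simp only [Matrix.of_apply, Finset.prod_mul_distrib]
  ring

theorem slater_cons {k : ℕ} (f : Fin (k + 1) → α → ℂ) (x : α) (z : Fin k → α) :
    (Matrix.of fun a b => f a ((Fin.cons x z : Fin (k + 1) → α) b)).det =
      ∑ a : Fin (k + 1), (-1) ^ (a : ℕ) * f a x *
        (Matrix.of fun i j => f (a.succAbove i) (z j)).det := by
  rw [Matrix.det_succ_column_zero]
  rfl

/-- Both determinants are expanded along the column of the first particle. The weight is absorbed
into the columns of one of the two minors, which puts each term in the form required by Andréief's
identity. -/
theorem slater_mul_slater {k : ℕ} (f : Fin (k + 1) → α → ℂ) (w : α → ℂ) (x y : α)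
    (z : Fin k → α) :
    (Matrix.of fun a b => f a ((Fin.cons x z : Fin (k + 1) → α) b)).det *
      conj (Matrix.of fun a b => f a ((Fin.cons y z : Fin (k + 1) → α) b)).det *
      ∏ j, w (z j) =
    ∑ a : Fin (k + 1), ∑ b : Fin (k + 1), f a x * conj (f b y) * (-1) ^ (a + b : ℕ) *
      ((Matrix.of fun i j => f (a.succAbove i) (z j) * w (z j)).det *
        (Matrix.of fun i j => conj (f (b.succAbove i) (z j))).det) := by
  have hw : ∀ a : Fin (k + 1), (Matrix.of fun i j => f (a.succAbove i) (z j) * w (z j)).det =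
      (∏ j, w (z j)) * (Matrix.of fun i j => f (a.succAbove i) (z j)).det := by
    intro a
    rw [← Matrix.det_mul_row]
    congr 1
    ext i j
    simp [mul_comm]
  have hc : ∀ b : Fin (k + 1), (Matrix.of fun i j => conj (f (b.succAbove i) (z j))).det =
      conj (Matrix.of fun i j => f (b.succAbove i) (z j)).det := by
    intro b
    rw [RingHom.map_det]
    rfl
  rw [slater_cons, slater_cons, map_sum, Finset.sum_mul_sum, Finset.sum_mul]
  refine Finset.sum_congr rfl fun a _ => ?_
  rw [Finset.sum_mul]
  refine Finset.sum_congr rfl fun b _ => ?_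
  rw [hw, hc]
  simp only [map_mul, map_pow, map_neg, map_one]
  ring

variable [MeasurableSpace α] {μ : Measure α} [SigmaFinite μ]

theorem integrable_det_mul_det {k : ℕ} {f g : Fin k → α → ℂ}
    (hfg : ∀ i j, Integrable (fun t => f i t * g j t) μ) :
    Integrable (fun z : Fin k → α => (Matrix.of fun i j => f i (z j)).det *
      (Matrix.of fun i j => g i (z j)).det) (Measure.pi fun _ => μ) := by
  simp only [det_mul_det_eq_sum]
  exact integrable_finsetSum _ fun τ _ => integrable_finsetSum _ fun σ _ =>
    (Integrable.fintype_prod (f := fun j t => f (σ j) t * g (τ j) t)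
      fun j => hfg _ _).const_mul _

/-- Andréief's identity. -/
theorem integral_det_mul_det {k : ℕ} {f g : Fin k → α → ℂ}
    (hfg : ∀ i j, Integrable (fun t => f i t * g j t) μ) :
    ∫ z : Fin k → α, (Matrix.of fun i j => f i (z j)).det *
      (Matrix.of fun i j => g i (z j)).det ∂(Measure.pi fun _ => μ) =
      (k.factorial : ℂ) * (Matrix.of fun i j => ∫ t, f i t * g j t ∂μ).det := by
  set M : Matrix (Fin k) (Fin k) ℂ := Matrix.of fun i j => ∫ t, f i t * g j t ∂μ with hM
  have hint : ∀ σ τ : Equiv.Perm (Fin k), Integrable (fun z : Fin k → α =>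
      (((Equiv.Perm.sign σ : ℤ) : ℂ) * ((Equiv.Perm.sign τ : ℤ) : ℂ)) *
        ∏ j, (f (σ j) (z j) * g (τ j) (z j))) (Measure.pi fun _ => μ) := fun σ τ =>
    (Integrable.fintype_prod (f := fun j t => f (σ j) t * g (τ j) t) fun j => hfg _ _).const_mul _
  simp only [det_mul_det_eq_sum]
  rw [integral_finsetSum _ fun τ _ => integrable_finsetSum _ fun σ _ => hint σ τ]
  -- For fixed `τ` the integral factorizes, and the sum over `σ` is the determinant of `M` with
  -- columns permuted by `τ`. The two signs of `τ` cancel, so all `k!` permutations contribute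
  -- equally.
  have hτ : ∀ τ : Equiv.Perm (Fin k), ∫ z : Fin k → α, ∑ σ : Equiv.Perm (Fin k),
      (((Equiv.Perm.sign σ : ℤ) : ℂ) * ((Equiv.Perm.sign τ : ℤ) : ℂ)) *
        ∏ j, (f (σ j) (z j) * g (τ j) (z j)) ∂(Measure.pi fun _ => μ) = M.det := by
    intro τ
    rw [integral_finsetSum _ fun σ _ => hint σ τ]
    have h1 : ∀ σ : Equiv.Perm (Fin k), ∫ z : Fin k → α,
        (((Equiv.Perm.sign σ : ℤ) : ℂ) * ((Equiv.Perm.sign τ : ℤ) : ℂ)) *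
          ∏ j, (f (σ j) (z j) * g (τ j) (z j)) ∂(Measure.pi fun _ => μ) =
        ((Equiv.Perm.sign τ : ℤ) : ℂ) *
          (((Equiv.Perm.sign σ : ℤ) : ℂ) * ∏ j, (M.submatrix id τ) (σ j) j) := by
      intro σ
      rw [integral_const_mul, integral_fintype_prod_eq_prod (μ := fun _ => μ)
        (fun j t => f (σ j) t * g (τ j) t)]
      simp only [hM, Matrix.submatrix_apply, id, Matrix.of_apply]
      ring
    simp only [h1]
    rw [← Finset.mul_sum, ← Matrix.det_apply', Matrix.det_permute', ← mul_assoc, ← Int.cast_mul,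
      Int.units_coe_mul_self, Int.cast_one, one_mul]
  simp only [hτ]
  rw [Finset.sum_const, Finset.card_univ, Fintype.card_perm, Fintype.card_fin, nsmul_eq_mul]

/-- The matrix `⟨f_b, w f_a⟩` of a multiplication operator. -/
noncomputable def weightMatrix (μ : Measure α) {N : ℕ} (f : Fin N → α → ℂ) (w : α → ℂ) :
    Matrix (Fin N) (Fin N) ℂ :=
  Matrix.of fun a b => ∫ t, f a t * w t * conj (f b t) ∂μ

theorem integrable_slater_mul_slater {k : ℕ} {f : Fin (k + 1) → α → ℂ} {w : α → ℂ}
    (hf : ∀ a b, Integrable (fun t => f a t * w t * conj (f b t)) μ) (x y : α) :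
    Integrable (fun z : Fin k → α =>
      (Matrix.of fun a b => f a ((Fin.cons x z : Fin (k + 1) → α) b)).det *
      conj (Matrix.of fun a b => f a ((Fin.cons y z : Fin (k + 1) → α) b)).det *
      ∏ j, w (z j)) (Measure.pi fun _ => μ) := by
  simp only [slater_mul_slater]
  exact integrable_finsetSum _ fun a _ => integrable_finsetSum _ fun b _ =>
    (integrable_det_mul_det (f := fun i t => f (a.succAbove i) t * w t)
      (g := fun i t => conj (f (b.succAbove i) t)) fun i j => hf _ _).const_mul _

/-- Andréief's identity turns the minors of Slater determinants into minors of the weight matrix;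
with the Laplace signs these are its cofactors. -/
theorem integral_slater_mul_slater {k : ℕ} {f : Fin (k + 1) → α → ℂ} {w : α → ℂ}
    (hf : ∀ a b, Integrable (fun t => f a t * w t * conj (f b t)) μ) (x y : α) :
    ∫ z : Fin k → α,
      (Matrix.of fun a b => f a ((Fin.cons x z : Fin (k + 1) → α) b)).det *
      conj (Matrix.of fun a b => f a ((Fin.cons y z : Fin (k + 1) → α) b)).det *
      ∏ j, w (z j) ∂(Measure.pi fun _ => μ) =
    (k.factorial : ℂ) * ∑ a : Fin (k + 1), ∑ b : Fin (k + 1),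
      f a x * conj (f b y) * (weightMatrix μ f w).adjugate b a := by
  have hint : ∀ a b : Fin (k + 1), Integrable (fun z : Fin k → α =>
      f a x * conj (f b y) * (-1) ^ (a + b : ℕ) *
      ((Matrix.of fun i j => f (a.succAbove i) (z j) * w (z j)).det *
        (Matrix.of fun i j => conj (f (b.succAbove i) (z j))).det)) (Measure.pi fun _ => μ) :=
    fun a b => (integrable_det_mul_det (f := fun i t => f (a.succAbove i) t * w t)
      (g := fun i t => conj (f (b.succAbove i) t)) fun i j => hf _ _).const_mul _
  simp only [slater_mul_slater]
  rw [integral_finsetSum _ fun a _ => integrable_finsetSum _ fun b _ => hint a b, Finset.mul_sum]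
  refine Finset.sum_congr rfl fun a _ => ?_
  rw [integral_finsetSum _ fun b _ => hint a b, Finset.mul_sum]
  refine Finset.sum_congr rfl fun b _ => ?_
  rw [integral_const_mul, integral_det_mul_det (f := fun i t => f (a.succAbove i) t * w t)
      (g := fun i t => conj (f (b.succAbove i) t)) fun i j => hf _ _,
    Matrix.adjugate_fin_succ_eq_det_submatrix]
  have : (Matrix.of fun i j => ∫ t, f (a.succAbove i) t * w t * conj (f (b.succAbove j) t) ∂μ) =
      (weightMatrix μ f w).submatrix a.succAbove b.succAbove := rfl
  rw [this]
  ring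

end Andreief

/-! ### The determinantal formula for the reduced density matrix. -/

section ReducedDensity

/-- The product of the signs picked up by a particle at `t` in the exchange with particles at `x`
and at `y`. -/
noncomputable def signWeight (x y t : ℝ) : ℂ :=
  ((Real.sign (x - t) * Real.sign (y - t) : ℝ) : ℂ)

theorem measurable_sign : Measurable Real.sign := by
  unfold Real.sign
  exact Measurable.ite measurableSet_Iio measurable_const
    (Measurable.ite measurableSet_Ioi measurable_const measurable_const)

theorem measurable_signWeight (x y : ℝ) : Measurable (signWeight x y) := by
  unfold signWeight
  have := measurable_sign
  fun_prop

theorem abs_sign_le_one (r : ℝ) : |Real.sign r| ≤ 1 := by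
  rcases Real.sign_apply_eq r with h | h | h <;> rw [h] <;> norm_num

theorem norm_signWeight_le_one (x y t : ℝ) : ‖signWeight x y t‖ ≤ 1 := by
  unfold signWeight
  rw [Complex.norm_real, Real.norm_eq_abs, abs_mul]
  exact mul_le_one₀ (abs_sign_le_one _) (abs_nonneg _) (abs_sign_le_one _)

/-- The sign factor of the bosonic wave function. -/
noncomputable def signProd {N : ℕ} (x : Fin N → ℝ) : ℝ :=
  ∏ i, ∏ k ∈ Finset.Ioi i, Real.sign (x i - x k)

theorem signProd_cons {k : ℕ} (x : ℝ) (z : Fin k → ℝ) :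
    signProd (Fin.cons x z : Fin (k + 1) → ℝ) = (∏ j, Real.sign (x - z j)) * signProd z := by
  unfold signProd
  rw [Fin.prod_univ_succ]
  simp [Fin.prod_Ioi_succ]

theorem signProd_mul_self {k : ℕ} {z : Fin k → ℝ} (hz : Function.Injective z) :
    signProd z * signProd z = 1 := by
  unfold signProd
  rw [← Finset.prod_mul_distrib]
  refine Finset.prod_eq_one fun i _ => ?_
  rw [← Finset.prod_mul_distrib]
  refine Finset.prod_eq_one fun j hj => ?_
  have hij : z i - z j ≠ 0 := sub_ne_zero.2 (hz.ne (ne_of_lt (Finset.mem_Ioi.1 hj)))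
  rcases Real.sign_apply_eq_of_ne_zero _ hij with h | h <;> rw [h] <;> norm_num

theorem bosonState_eq {N : ℕ} (f : Fin N → ℝ → ℂ) (x : Fin N → ℝ) :
    bosonState f x = ((1 / Real.sqrt (N.factorial) : ℝ) : ℂ) *
      (Matrix.of fun a b => f a (x b)).det * ((signProd x : ℝ) : ℂ) := by
  unfold bosonState signProd
  push_cast
  rfl

/-- At coinciding positions `Real.sign 0 = 0` spoils the cancellation of signs. There the
determinant vanishes anyway, so the product formula below holds pointwise and not just almost
everywhere. -/
theorem slater_cons_eq_zero {k : ℕ} (f : Fin (k + 1) → ℝ → ℂ) (x : ℝ) {z : Fin k → ℝ}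
    (hz : ¬ Function.Injective z) :
    (Matrix.of fun a b => f a ((Fin.cons x z : Fin (k + 1) → ℝ) b)).det = 0 := by
  simp only [Function.Injective, not_forall] at hz
  obtain ⟨i, j, hij, hne⟩ := hz
  refine Matrix.det_zero_of_column_eq (i := i.succ) (j := j.succ)
    (fun h => hne (Fin.succ_injective _ h)) fun a => ?_
  simp [hij]

theorem bosonState_mul_bosonState {k : ℕ} (f : Fin (k + 1) → ℝ → ℂ) (x y : ℝ) (z : Fin k → ℝ) :
    bosonState f (Fin.cons x z) * conj (bosonState f (Fin.cons y z)) =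
      ((((k + 1).factorial : ℝ)⁻¹ : ℝ) : ℂ) *
      ((Matrix.of fun a b => f a ((Fin.cons x z : Fin (k + 1) → ℝ) b)).det *
      conj (Matrix.of fun a b => f a ((Fin.cons y z : Fin (k + 1) → ℝ) b)).det *
      ∏ j, signWeight x y (z j)) := by
  rw [bosonState_eq, bosonState_eq]
  by_cases hz : Function.Injective z
  · have h1 : ((signProd (Fin.cons x z : Fin (k + 1) → ℝ) : ℝ) : ℂ) *
        ((signProd (Fin.cons y z : Fin (k + 1) → ℝ) : ℝ) : ℂ) = ∏ j, signWeight x y (z j) := by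
      rw [signProd_cons, signProd_cons, ← Complex.ofReal_mul, mul_mul_mul_comm,
        signProd_mul_self hz, mul_one, ← Finset.prod_mul_distrib]
      simp [signWeight]
    have h2 : ((1 / Real.sqrt ((k + 1).factorial) : ℝ) : ℂ) *
        ((1 / Real.sqrt ((k + 1).factorial) : ℝ) : ℂ) =
        ((((k + 1).factorial : ℝ)⁻¹ : ℝ) : ℂ) := by
      rw [← Complex.ofReal_mul, div_mul_div_comm, one_mul,
        Real.mul_self_sqrt (by positivity), one_div]
    rw [← h1, ← h2]
    simp only [map_mul, Complex.conj_ofReal]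
    ring
  · rw [slater_cons_eq_zero f x hz]
    simp

/-- The family `f` is orthonormal in `L²([0, L])`. -/
structure IsOrthonormalOn (L : ℕ) {N : ℕ} (f : Fin N → ℝ → ℂ) : Prop where
  measurable : ∀ a, Measurable (f a)
  memLp : ∀ a, MemLp (f a) 2 (ringMeasure L)
  orthonormal : ∀ a b, ∫ t, conj (f a t) * f b t ∂(ringMeasure L) = if a = b then 1 else 0

instance (L : ℕ) : IsFiniteMeasure (ringMeasure L) := by
  unfold ringMeasure
  infer_instance

variable {L : ℕ}

theorem IsOrthonormalOn.integrable {N : ℕ} {f : Fin N → ℝ → ℂ} (hf : IsOrthonormalOn L f)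
    {w : ℝ → ℂ} (hw : Measurable w) (hw1 : ∀ t, ‖w t‖ ≤ 1) (a b : Fin N) :
    Integrable (fun t => f a t * w t * conj (f b t)) (ringMeasure L) := by
  have h1 : MemLp (fun t => conj (f b t)) 2 (ringMeasure L) := (hf.memLp b).star
  have h2 : MemLp (fun t => f a t * w t) 2 (ringMeasure L) := by
    refine (hf.memLp a).mono ((hf.measurable a).mul hw).aestronglyMeasurable ?_
    refine Eventually.of_forall fun t => ?_
    rw [norm_mul]
    exact mul_le_of_le_one_right (norm_nonneg _) (hw1 t)
  exact h2.integrable_mul h1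

theorem IsOrthonormalOn.weightMatrix_one {N : ℕ} {f : Fin N → ℝ → ℂ}
    (hf : IsOrthonormalOn L f) : weightMatrix (ringMeasure L) f (fun _ => 1) = 1 := by
  ext a b
  have := hf.orthonormal b a
  simp only [weightMatrix, Matrix.of_apply, mul_one, Matrix.one_apply]
  simp only [mul_comm (conj _)] at this
  rw [this]
  simp [eq_comm]

/-- The determinantal formula for the reduced one-particle density matrix. -/
theorem reducedDensity_bosonState {k : ℕ} {f : Fin (k + 1) → ℝ → ℂ} (hf : IsOrthonormalOn L f)
    (x y : ℝ) :
    reducedDensity L (bosonState f) x y = ∑ a, ∑ b, f a x * conj (f b y) *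
      (weightMatrix (ringMeasure L) f (signWeight x y)).adjugate b a := by
  have hμ : (volume.restrict (Set.pi univ fun _ : Fin k => Ioc (0 : ℝ) L)) =
      Measure.pi fun _ => ringMeasure L := by
    rw [volume_pi, Measure.restrict_pi_pi]
    rfl
  simp only [reducedDensity, bosonState_mul_bosonState]
  rw [hμ, integral_const_mul, integral_slater_mul_slater
    (hf.integrable (measurable_signWeight x y) (norm_signWeight_le_one x y))]
  rw [← mul_assoc, ← mul_assoc]
  have : ((k + 1 : ℕ) : ℂ) * ((((k + 1).factorial : ℝ)⁻¹ : ℝ) : ℂ) * (k.factorial : ℂ) = 1 := by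
    have h1 : ((k + 1 : ℕ) : ℂ) ≠ 0 := by exact_mod_cast k.succ_ne_zero
    have h2 : (k.factorial : ℂ) ≠ 0 := by exact_mod_cast k.factorial_ne_zero
    rw [Nat.factorial_succ]
    push_cast at h1 ⊢
    field_simp
  rw [this, one_mul]

/-- For the weight 1 orthonormality makes the weight matrix and its adjugate the identity, so only
the diagonal of the double sum survives. -/
theorem integral_norm_slater_sq {k : ℕ} {f : Fin (k + 1) → ℝ → ℂ} (hf : IsOrthonormalOn L f)
    (x : ℝ) :
    Integrable (fun z : Fin k → ℝ =>
      ‖(Matrix.of fun a b => f a ((Fin.cons x z : Fin (k + 1) → ℝ) b)).det‖ ^ 2)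
      (Measure.pi fun _ => ringMeasure L) ∧
    ∫ z : Fin k → ℝ,
      ‖(Matrix.of fun a b => f a ((Fin.cons x z : Fin (k + 1) → ℝ) b)).det‖ ^ 2
      ∂(Measure.pi fun _ => ringMeasure L) = (k.factorial : ℝ) * ∑ a, ‖f a x‖ ^ 2 := by
  have hw := hf.integrable (w := fun _ => 1) measurable_const (fun _ => by simp)
  have h1 := integrable_slater_mul_slater hw x x
  have h2 := integral_slater_mul_slater hw x x
  simp only [Finset.prod_const_one, mul_one, Complex.mul_conj', hf.weightMatrix_one,
    Matrix.adjugate_one] at h1 h2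
  have h3 : Integrable (fun z : Fin k → ℝ =>
      ‖(Matrix.of fun a b => f a ((Fin.cons x z : Fin (k + 1) → ℝ) b)).det‖ ^ 2)
      (Measure.pi fun _ => ringMeasure L) := by
    have := h1.re
    refine this.congr (Eventually.of_forall fun z => ?_)
    simp only [RCLike.re_to_complex]
    exact_mod_cast Complex.ofReal_re _
  refine ⟨h3, Complex.ofReal_injective ?_⟩
  rw [← integral_complex_ofReal]
  push_cast
  rw [h2]
  congr 1
  refine Finset.sum_congr rfl fun a _ => ?_
  rw [Finset.sum_eq_single a]
  · simp [Complex.mul_conj']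
  · intro b _ hb
    simp [hb]
  · simp

/-- Cauchy--Schwarz bound of the reduced density matrix by the particle density. -/
theorem norm_reducedDensity_le {k : ℕ} {f : Fin (k + 1) → ℝ → ℂ} (hf : IsOrthonormalOn L f)
    (x y : ℝ) :
    ‖reducedDensity L (bosonState f) x y‖ ≤
      Real.sqrt (∑ a, ‖f a x‖ ^ 2) * Real.sqrt (∑ a, ‖f a y‖ ^ 2) := by
  have hμ : (volume.restrict (Set.pi univ fun _ : Fin k => Ioc (0 : ℝ) L)) =
      Measure.pi fun _ => ringMeasure L := by
    rw [volume_pi, Measure.restrict_pi_pi]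
    rfl
  set D : ℝ → (Fin k → ℝ) → ℂ := fun x z =>
    (Matrix.of fun a b => f a ((Fin.cons x z : Fin (k + 1) → ℝ) b)).det with hD
  have hmeas : ∀ x, Measurable (D x) := by
    intro x
    simp only [hD, Matrix.det_apply']
    have := hf.measurable
    simp only [Matrix.of_apply]
    fun_prop
  have hmem : ∀ x, MemLp (fun z => ‖D x z‖) (ENNReal.ofReal 2)
      (Measure.pi fun _ => ringMeasure L) := by
    intro x
    rw [ENNReal.ofReal_ofNat]
    exact ((memLp_two_iff_integrable_sq_norm (hmeas x).aestronglyMeasurable).2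
      (integral_norm_slater_sq hf x).1).norm
  have hint : Integrable (fun z => ‖D x z‖ * ‖D y z‖) (Measure.pi fun _ => ringMeasure L) := by
    have h1 := hmem x
    have h2 := hmem y
    rw [ENNReal.ofReal_ofNat] at h1 h2
    exact h1.integrable_mul h2
  -- Cauchy--Schwarz in the integrated positions; the sign weights are at most one in modulus and
  -- are dropped.
  have hCS := integral_mul_le_Lp_mul_Lq_of_nonneg Real.HolderConjugate.two_two
    (Eventually.of_forall fun z => norm_nonneg (D x z))
    (Eventually.of_forall fun z => norm_nonneg (D y z)) (hmem x) (hmem y)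
  have hsq : ∀ x, (∫ z, ‖D x z‖ ^ (2 : ℝ) ∂(Measure.pi fun _ => ringMeasure L)) ^ (1 / 2 : ℝ) =
      Real.sqrt (k.factorial) * Real.sqrt (∑ a, ‖f a x‖ ^ 2) := by
    intro x
    simp only [Real.rpow_two]
    rw [(integral_norm_slater_sq hf x).2, ← Real.sqrt_eq_rpow, Real.sqrt_mul (by positivity)]
  rw [hsq, hsq] at hCS
  simp only [reducedDensity, bosonState_mul_bosonState]
  rw [hμ, integral_const_mul, norm_mul, norm_mul]
  have hle : ‖∫ z : Fin k → ℝ, D x z * conj (D y z) * ∏ j, signWeight x y (z j)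
      ∂(Measure.pi fun _ => ringMeasure L)‖ ≤
      ∫ z, ‖D x z‖ * ‖D y z‖ ∂(Measure.pi fun _ => ringMeasure L) := by
    refine norm_integral_le_of_norm_le hint (Eventually.of_forall fun z => ?_)
    rw [norm_mul, norm_mul, RCLike.norm_conj, norm_prod]
    exact mul_le_of_le_one_right (by positivity)
      (Finset.prod_le_one (fun _ _ => norm_nonneg _) fun _ _ => norm_signWeight_le_one _ _ _)
  have hconst : ‖((k + 1 : ℕ) : ℂ)‖ * ‖((((k + 1).factorial : ℝ)⁻¹ : ℝ) : ℂ)‖ *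
      (k.factorial : ℝ) = 1 := by
    rw [Complex.norm_natCast, Complex.norm_real, Real.norm_of_nonneg (by positivity),
      Nat.factorial_succ]
    have h2 : (k.factorial : ℝ) ≠ 0 := by exact_mod_cast k.factorial_ne_zero
    push_cast
    field_simp
  calc _ ≤ ‖((k + 1 : ℕ) : ℂ)‖ * (‖((((k + 1).factorial : ℝ)⁻¹ : ℝ) : ℂ)‖ *
        (Real.sqrt (k.factorial) * Real.sqrt (∑ a, ‖f a x‖ ^ 2) *
          (Real.sqrt (k.factorial) * Real.sqrt (∑ a, ‖f a y‖ ^ 2)))) := by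
        gcongr
        exact hle.trans hCS
    _ = ‖((k + 1 : ℕ) : ℂ)‖ * ‖((((k + 1).factorial : ℝ)⁻¹ : ℝ) : ℂ)‖ *
        (Real.sqrt (k.factorial) * Real.sqrt (k.factorial)) *
        (Real.sqrt (∑ a, ‖f a x‖ ^ 2) * Real.sqrt (∑ a, ‖f a y‖ ^ 2)) := by ring
    _ = _ := by rw [Real.mul_self_sqrt (by positivity), hconst, one_mul]

end ReducedDensity

/-! ### Masses in unit cells and entries of the weight matrix. -/

section Cells

theorem cell_subset {L n : ℕ} (h1 : 1 ≤ n) (h2 : n ≤ L) : cell n ⊆ Ioc (0 : ℝ) L := by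
  intro x hx
  have h1' : (1 : ℝ) ≤ n := by exact_mod_cast h1
  have h2' : (n : ℝ) ≤ L := by exact_mod_cast h2
  exact ⟨by linarith [hx.1], hx.2.trans h2'⟩

theorem measurableSet_cell (n : ℕ) : MeasurableSet (cell n) := measurableSet_Ioc

theorem lintegral_ringMeasure (L : ℕ) (g : ℝ → ℝ≥0∞) :
    ∫⁻ x, g x ∂(ringMeasure L) = ∑ n ∈ Finset.Icc 1 L, ∫⁻ x in cell n, g x := by
  unfold ringMeasure
  induction L with
  | zero => simp
  | succ L ih =>
    rw [Finset.sum_Icc_succ_top (by omega), ← ih]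
    have hcell : cell (L + 1) = Ioc (L : ℝ) ((L + 1 : ℕ) : ℝ) := by
      unfold cell
      push_cast
      rw [add_sub_cancel_right]
    have hun : Ioc (0 : ℝ) ((L + 1 : ℕ) : ℝ) = Ioc (0 : ℝ) L ∪ cell (L + 1) := by
      rw [hcell, Ioc_union_Ioc_eq_Ioc (by positivity) (by push_cast; linarith)]
    rw [hun, lintegral_union (measurableSet_cell _)]
    rw [hcell]
    exact Set.Ioc_disjoint_Ioc_of_le le_rfl

theorem cellNorm_sq (f : ℝ → ℂ) (n : ℕ) : cellNorm f n ^ 2 = ∫⁻ x in cell n, ‖f x‖ₑ ^ 2 := by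
  unfold cellNorm
  rw [← ENNReal.rpow_natCast, ← ENNReal.rpow_mul]
  norm_num

/-- Cauchy--Schwarz for the lower integral. -/
theorem lintegral_mul_sq_le {α : Type*} [MeasurableSpace α] {μ : Measure α} {f g : α → ℝ≥0∞}
    (hf : AEMeasurable f μ) (hg : AEMeasurable g μ) :
    (∫⁻ x, f x * g x ∂μ) ^ 2 ≤ (∫⁻ x, f x ^ 2 ∂μ) * ∫⁻ x, g x ^ 2 ∂μ := by
  have h := ENNReal.lintegral_mul_le_Lp_mul_Lq μ Real.HolderConjugate.two_two hf hg
  simp only [Pi.mul_apply, ENNReal.rpow_two] at h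
  calc _ ≤ ((∫⁻ x, f x ^ 2 ∂μ) ^ (1 / 2 : ℝ) * (∫⁻ x, g x ^ 2 ∂μ) ^ (1 / 2 : ℝ)) ^ 2 :=
        pow_le_pow_left' h 2
    _ = _ := by
        rw [mul_pow, ← ENNReal.rpow_natCast, ← ENNReal.rpow_natCast, ← ENNReal.rpow_mul,
          ← ENNReal.rpow_mul]
        norm_num

theorem ennreal_sq_sum_le {ι : Type*} (s : Finset ι) (a : ι → ℝ≥0∞) :
    (∑ i ∈ s, a i) ^ 2 ≤ s.card * ∑ i ∈ s, a i ^ 2 := by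
  have h := ENNReal.inner_le_Lp_mul_Lq s (fun _ => 1) a Real.HolderConjugate.two_two
  simp only [one_mul, ENNReal.rpow_two, one_pow, Finset.sum_const, nsmul_eq_mul, mul_one] at h
  calc _ ≤ ((s.card : ℝ≥0∞) ^ (1 / 2 : ℝ) * (∑ i ∈ s, a i ^ 2) ^ (1 / 2 : ℝ)) ^ 2 :=
        pow_le_pow_left' h 2
    _ = _ := by
        rw [mul_pow, ← ENNReal.rpow_natCast, ← ENNReal.rpow_natCast, ← ENNReal.rpow_mul,
          ← ENNReal.rpow_mul]
        norm_num

theorem lintegral_cell_mul_le {f g : ℝ → ℂ} (hf : Measurable f) (hg : Measurable g) (n : ℕ) :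
    ∫⁻ x in cell n, ‖f x‖ₑ * ‖g x‖ₑ ≤ cellNorm f n * cellNorm g n := by
  have h := lintegral_mul_sq_le (μ := volume.restrict (cell n)) hf.enorm.aemeasurable
    hg.enorm.aemeasurable
  rw [← cellNorm_sq, ← cellNorm_sq, ← mul_pow] at h
  exact (ENNReal.pow_le_pow_left_iff two_ne_zero).1 h

variable {L N : ℕ} {f : Fin N → ℝ → ℂ}

theorem IsOrthonormalOn.lintegral_sq (hf : IsOrthonormalOn L f) (a : Fin N) :
    ∫⁻ x, ‖f a x‖ₑ ^ 2 ∂(ringMeasure L) = 1 := by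
  have h1 := hf.orthonormal a a
  simp only [Complex.conj_mul', if_true] at h1
  have h2 : ∫ x, ‖f a x‖ ^ 2 ∂(ringMeasure L) = 1 := by
    apply Complex.ofReal_injective
    rw [← integral_complex_ofReal]
    push_cast
    exact h1
  have h3 : Integrable (fun x => ‖f a x‖ ^ 2) (ringMeasure L) :=
    (memLp_two_iff_integrable_sq_norm (hf.measurable a).aestronglyMeasurable).1 (hf.memLp a)
  have h4 := ofReal_integral_eq_lintegral_ofReal h3 (Eventually.of_forall fun x => by positivity)
  rw [h2, ENNReal.ofReal_one] at h4
  rw [h4]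
  refine lintegral_congr fun x => ?_
  rw [ENNReal.ofReal_pow (norm_nonneg _), ofReal_norm]

theorem IsOrthonormalOn.sum_cellNorm_sq (hf : IsOrthonormalOn L f) (a : Fin N) :
    ∑ n ∈ Finset.Icc 1 L, cellNorm (f a) n ^ 2 = 1 := by
  simp only [cellNorm_sq]
  rw [← lintegral_ringMeasure, hf.lintegral_sq]

theorem IsOrthonormalOn.cellNorm_le_one (hf : IsOrthonormalOn L f) (a : Fin N) {n : ℕ}
    (hn : n ∈ Finset.Icc 1 L) : cellNorm (f a) n ≤ 1 := by
  refine (ENNReal.pow_le_pow_left_iff two_ne_zero).1 ?_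
  rw [one_pow, ← hf.sum_cellNorm_sq a]
  exact Finset.single_le_sum (f := fun n => cellNorm (f a) n ^ 2) (fun _ _ => zero_le) hn

/-- Every normalized function has a cell that carries at least the fraction `1 / L` of its mass. -/
theorem IsOrthonormalOn.exists_center (hf : IsOrthonormalOn L f) (a : Fin N) :
    ∃ n ∈ Finset.Icc 1 L, 1 ≤ L * cellNorm (f a) n ^ 2 := by
  by_contra! h
  rcases Nat.eq_zero_or_pos L with rfl | hL
  · have := hf.sum_cellNorm_sq a
    simp at this
  have hne : (Finset.Icc 1 L).Nonempty := ⟨1, by simp; omega⟩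
  have h1 : ∑ n ∈ Finset.Icc 1 L, L * cellNorm (f a) n ^ 2 = L := by
    rw [← Finset.mul_sum, hf.sum_cellNorm_sq, mul_one]
  have h2 : ∑ n ∈ Finset.Icc 1 L, L * cellNorm (f a) n ^ 2 < ∑ n ∈ Finset.Icc 1 L, 1 :=
    ENNReal.sum_lt_sum_of_nonempty hne h
  rw [h1] at h2
  simp at h2

/-- Bessel's inequality for the rows of a weight matrix. -/
theorem IsOrthonormalOn.sum_norm_sq_weightMatrix_le (hf : IsOrthonormalOn L f) {w : ℝ → ℂ}
    (hw : Measurable w) (hw1 : ∀ t, ‖w t‖ ≤ 1) (a : Fin N) :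
    ∑ b, ‖weightMatrix (ringMeasure L) f w a b‖ ^ 2 ≤ 1 := by
  have hinner : ∀ (u v : ℝ → ℂ) (hu : MemLp u 2 (ringMeasure L)) (hv : MemLp v 2 (ringMeasure L)),
      inner ℂ hu.toLp hv.toLp = ∫ t, conj (u t) * v t ∂(ringMeasure L) := by
    intro u v hu hv
    rw [L2.inner_def]
    refine integral_congr_ae ?_
    filter_upwards [hu.coeFn_toLp, hv.coeFn_toLp] with t h1 h2
    rw [h1, h2, RCLike.inner_apply, mul_comm]
  have ho : Orthonormal ℂ fun b => (hf.memLp b).toLp := by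
    rw [orthonormal_iff_ite]
    intro i j
    rw [hinner, hf.orthonormal]
  have hm : MemLp (fun t => f a t * w t) 2 (ringMeasure L) := by
    refine (hf.memLp a).mono ((hf.measurable a).mul hw).aestronglyMeasurable ?_
    refine Eventually.of_forall fun t => ?_
    rw [norm_mul]
    exact mul_le_of_le_one_right (norm_nonneg _) (hw1 t)
  have hB := ho.sum_inner_products_le (s := Finset.univ) hm.toLp
  have hnorm : ‖hm.toLp‖ ≤ 1 := by
    rw [← ho.1 a]
    refine Lp.norm_le_norm_of_ae_le ?_
    filter_upwards [hm.coeFn_toLp, (hf.memLp a).coeFn_toLp] with t h1 h2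
    rw [h1, h2, norm_mul]
    exact mul_le_of_le_one_right (norm_nonneg _) (hw1 t)
  refine le_trans (le_of_eq ?_) (hB.trans (pow_le_one₀ (norm_nonneg _) hnorm))
  refine Finset.sum_congr rfl fun b _ => ?_
  rw [hinner]
  simp only [weightMatrix, Matrix.of_apply]
  congr 2
  refine integral_congr_ae (Eventually.of_forall fun t => ?_)
  ring

/-- Off-diagonal entries of a weight matrix are small if, cell by cell, the weight is equal to a
fixed constant or one of the two functions is small. -/
theorem IsOrthonormalOn.enorm_weightMatrix_le (hf : IsOrthonormalOn L f) {w : ℝ → ℂ}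
    (hw : Measurable w) (hw1 : ∀ t, ‖w t‖ ≤ 1) {a b : Fin N} (hab : a ≠ b) {c : ℂ} (hc : ‖c‖ ≤ 1)
    {κ : ℝ≥0∞} (h : ∀ n ∈ Finset.Icc 1 L, (∀ z ∈ cell n, w z = c) ∨
      cellNorm (f a) n * cellNorm (f b) n ≤ κ) :
    ‖weightMatrix (ringMeasure L) f w a b‖ₑ ≤ 2 * L * κ := by
  -- By orthogonality the constant `c` may be subtracted from the weight, after which the cells with
  -- `w = c` drop out. In the others `|w - c| ≤ 2`, and there are at most `L` of them.
  have h0 : ∫ t, f a t * c * conj (f b t) ∂(ringMeasure L) = 0 := by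
    have := hf.orthonormal b a
    rw [if_neg hab.symm] at this
    rw [← mul_zero c, ← this, ← integral_const_mul]
    refine integral_congr_ae (Eventually.of_forall fun t => ?_)
    ring
  have h1 : weightMatrix (ringMeasure L) f w a b =
      ∫ t, (w t - c) * (f a t * conj (f b t)) ∂(ringMeasure L) := by
    simp only [weightMatrix, Matrix.of_apply]
    rw [← sub_zero (∫ t, f a t * w t * conj (f b t) ∂(ringMeasure L)), ← h0, ← integral_sub
      (hf.integrable hw hw1 a b) (hf.integrable (w := fun _ => c) measurable_const (fun _ => hc) a b)]
    refine integral_congr_ae (Eventually.of_forall fun t => ?_)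
    ring
  have hwc : ∀ t, ‖w t - c‖ₑ ≤ 2 := by
    intro t
    rw [← ofReal_norm, ← ENNReal.ofReal_ofNat]
    exact ENNReal.ofReal_le_ofReal ((norm_sub_le _ _).trans (by linarith [hw1 t]))
  have hcell : ∀ n ∈ Finset.Icc 1 L,
      ∫⁻ t in cell n, ‖(w t - c) * (f a t * conj (f b t))‖ₑ ≤ 2 * κ := by
    intro n hn
    rcases h n hn with h2 | h2
    · rw [setLIntegral_congr_fun (g := fun _ => 0) (measurableSet_cell n)]
      · simp
      · intro t ht
        simp only
        rw [h2 t ht, sub_self, zero_mul, enorm_zero]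
    · calc _ ≤ ∫⁻ t in cell n, 2 * (‖f a t‖ₑ * ‖f b t‖ₑ) := by
            refine lintegral_mono fun t => ?_
            simp only [enorm_mul, RCLike.enorm_conj]
            gcongr
            exact hwc t
        _ = 2 * ∫⁻ t in cell n, ‖f a t‖ₑ * ‖f b t‖ₑ :=
            lintegral_const_mul' _ _ (by norm_num)
        _ ≤ 2 * κ := by
            gcongr
            exact (lintegral_cell_mul_le (hf.measurable a) (hf.measurable b) n).trans h2
  rw [h1]
  calc _ ≤ ∫⁻ t, ‖(w t - c) * (f a t * conj (f b t))‖ₑ ∂(ringMeasure L) :=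
        enorm_integral_le_lintegral_enorm _
    _ ≤ ∑ n ∈ Finset.Icc 1 L, 2 * κ := by
        rw [lintegral_ringMeasure]
        exact Finset.sum_le_sum hcell
    _ = 2 * L * κ := by
        rw [Finset.sum_const, Nat.card_Icc, nsmul_eq_mul, Nat.add_sub_cancel]
        ring

end Cells

/-! ### Geometry of the discrete torus. -/

section Torus

/-- The distance on the discrete torus `{1, …, L}`. -/
def natTorusDist (L n m : ℕ) : ℕ := min (max n m - min n m) (L - (max n m - min n m))

theorem natTorusDist_comm (L n m : ℕ) : natTorusDist L n m = natTorusDist L m n := by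
  unfold natTorusDist
  omega

theorem torusDist_eq_natTorusDist {L n m : ℕ} (hn : n ≤ L) (hm : m ≤ L) :
    torusDist L n m = natTorusDist L n m := by
  have h : |(n : ℝ) - m| = ((max n m - min n m : ℕ) : ℝ) := by
    rcases le_total n m with h | h
    · rw [max_eq_right h, min_eq_left h, Nat.cast_sub h, abs_sub_comm, abs_of_nonneg]
      exact sub_nonneg.2 (by exact_mod_cast h)
    · rw [max_eq_left h, min_eq_right h, Nat.cast_sub h, abs_of_nonneg]
      exact sub_nonneg.2 (by exact_mod_cast h)
  unfold torusDist natTorusDist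
  rw [h, Nat.cast_min, Nat.cast_sub (n := L)]
  omega

theorem natTorusDist_triangle {L a b t : ℕ} (ha : a ∈ Finset.Icc 1 L) (hb : b ∈ Finset.Icc 1 L)
    (ht : t ∈ Finset.Icc 1 L) :
    natTorusDist L a b ≤ natTorusDist L a t + natTorusDist L t b := by
  simp only [Finset.mem_Icc] at ha hb ht
  unfold natTorusDist
  omega

/-- Apart from the interval around `n`, with fewer than `8 * D` points, a ball may wrap around and
meet the first or the last `4 * D` cells. -/
theorem card_filter_natTorusDist_lt {L n D : ℕ} (hD : 1 ≤ D) (hn : n ≤ L) :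
    ((Finset.Icc 1 L).filter fun m => natTorusDist L n m < 4 * D).card ≤ 17 * D := by
  have hsub : ((Finset.Icc 1 L).filter fun m => natTorusDist L n m < 4 * D) ⊆
      (Finset.Ico (n + 1 - 4 * D) (n + 4 * D) ∪ Finset.Icc 1 (4 * D)) ∪
        Finset.Icc (L + 1 - 4 * D) L := by
    intro m hm
    simp only [Finset.mem_filter, Finset.mem_Icc, Finset.mem_union, Finset.mem_Ico] at hm ⊢
    unfold natTorusDist at hm
    omega
  refine (Finset.card_le_card hsub).trans ((Finset.card_union_le _ _).trans ?_)
  have := Finset.card_union_le (Finset.Ico (n + 1 - 4 * D) (n + 4 * D)) (Finset.Icc 1 (4 * D))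
  simp only [Nat.card_Ico, Nat.card_Icc] at this ⊢
  omega

/-- The value of `sign (x - z)` for `x` in the cell `n` and `z` in another cell `t`. -/
def cellSign (n t : ℕ) : ℝ := if t < n then 1 else -1

theorem sign_sub_eq_cellSign {n t : ℕ} (hnt : t ≠ n) {x z : ℝ} (hx : x ∈ cell n)
    (hz : z ∈ cell t) : Real.sign (x - z) = cellSign n t := by
  unfold cellSign
  split_ifs with h
  · have : (t : ℝ) ≤ n - 1 := by
      have : (t : ℝ) + 1 ≤ n := by exact_mod_cast h
      linarith
    exact Real.sign_of_pos (by linarith [hx.1, hz.2])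
  · have : (n : ℝ) ≤ t - 1 := by
      have : (n : ℝ) + 1 ≤ t := by
        have : n + 1 ≤ t := by omega
        exact_mod_cast this
      linarith
    exact Real.sign_of_neg (by linarith [hx.2, hz.1])

/-- The sign weight does not change within a ball that avoids the cells of both particles. -/
theorem cellSign_mul_cellSign_eq {L D n m b t : ℕ} (hn : n ∈ Finset.Icc 1 L)
    (hm : m ∈ Finset.Icc 1 L) (hb : b ∈ Finset.Icc 1 L) (ht : t ∈ Finset.Icc 1 L)
    (hbn : D ≤ natTorusDist L b n) (hbm : D ≤ natTorusDist L b m)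
    (hbt : natTorusDist L b t < D) :
    t ≠ n ∧ t ≠ m ∧ cellSign n t * cellSign m t = cellSign n b * cellSign m b := by
  simp only [Finset.mem_Icc] at hn hm hb ht
  have h1 : t ≠ n := by
    rintro rfl
    omega
  have h2 : t ≠ m := by
    rintro rfl
    omega
  -- `t` and `b` lie on the same arc of the torus cut at `n` and `m`. Crossing the seam between `L`
  -- and `1` flips both comparisons and leaves the product of signs unchanged.
  have h3 : (t < n ↔ t < m) ↔ (b < n ↔ b < m) := by
    unfold natTorusDist at *
    omega
  refine ⟨h1, h2, ?_⟩
  unfold cellSign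
  split_ifs <;> simp_all

theorem abs_cellSign (n t : ℕ) : |cellSign n t| = 1 := by
  unfold cellSign
  split_ifs <;> simp

end Torus

/-! ### A Schur test for block kernels. -/

section BlockKernel

theorem ennreal_add_sq_le (a b : ℝ≥0∞) : (a + b) ^ 2 ≤ 2 * (a ^ 2 + b ^ 2) := by
  have := ennreal_sq_sum_le (Finset.univ : Finset (Fin 2)) ![a, b]
  simpa [Fin.sum_univ_two] using this

/-- A Schur type bound on the norm of an integral operator in terms of the Hilbert--Schmidt norms
of its blocks, which are at most `ρ` near the diagonal and at most `η` away from it. -/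
theorem kernelNorm_le {L R K : ℕ} {k : ℝ → ℝ → ℂ} {ρ η : ℝ≥0∞}
    (hK : ∀ n ∈ Finset.Icc 1 L,
      ((Finset.Icc 1 L).filter fun m => natTorusDist L n m < R).card ≤ K)
    (hk : ∀ n ∈ Finset.Icc 1 L, ∀ m ∈ Finset.Icc 1 L, ∃ G : ℝ → ℝ → ℝ≥0∞,
      Measurable (Function.uncurry G) ∧ (∀ x ∈ cell n, ∀ y ∈ cell m, ‖k x y‖ₑ ≤ G x y) ∧
      ∫⁻ x in cell n, ∫⁻ y in cell m, G x y ^ 2 ≤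
        (if natTorusDist L n m < R then ρ else η) ^ 2) :
    kernelNorm L k ≤ 2 * (K * ρ + L * η) := by
  unfold kernelNorm
  refine iSup_le fun f => iSup_le fun hf => ?_
  have hfm : AEStronglyMeasurable f (ringMeasure L) := Lp.aestronglyMeasurable f
  have hfcell : ∀ m ∈ Finset.Icc 1 L, AEMeasurable (fun y => ‖f y‖ₑ) (volume.restrict (cell m)) := by
    intro m hm
    obtain ⟨h1, h2⟩ := Finset.mem_Icc.1 hm
    exact (hfm.mono_measure (Measure.restrict_mono (cell_subset h1 h2) le_rfl)).enorm
  set F : ℕ → ℝ≥0∞ := fun m => ∫⁻ y in cell m, ‖f y‖ₑ ^ 2 with hF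
  have hFsum : ∑ m ∈ Finset.Icc 1 L, F m ≤ 1 := by
    rw [hF, ← lintegral_ringMeasure]
    have h1 : eLpNorm f 2 (ringMeasure L) ≤ 1 := by
      rw [← ENNReal.ofReal_toReal (Lp.eLpNorm_ne_top f), ← Lp.norm_def, ← ENNReal.ofReal_one]
      exact ENNReal.ofReal_le_ofReal hf
    rw [eLpNorm_eq_lintegral_rpow_enorm_toReal (by norm_num) (by norm_num)] at h1
    simp only [ENNReal.toReal_ofNat, ENNReal.rpow_two] at h1
    rwa [one_div, ENNReal.rpow_inv_le_iff (by norm_num), ENNReal.one_rpow] at h1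
  rw [eLpNorm_eq_lintegral_rpow_enorm_toReal (by norm_num) (by norm_num)]
  simp only [ENNReal.toReal_ofNat, ENNReal.rpow_two]
  rw [one_div, ENNReal.rpow_inv_le_iff (by norm_num), ENNReal.rpow_two, lintegral_ringMeasure]
  -- The majorants carry the measurability needed to exchange sums and integrals; `k` itself need
  -- not be measurable.
  choose! G hGm hGk hGi using hk
  set h : ℕ → ℕ → ℝ → ℝ≥0∞ := fun n m x => ∫⁻ y in cell m, G n m x y ^ 2 with hh
  -- Cauchy--Schwarz in `y` within each cell, then over the cells, separately for the at most `K`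
  -- near ones and the at most `L` others.
  have hpoint : ∀ n ∈ Finset.Icc 1 L, ∀ x ∈ cell n,
      ‖∫ y, k x y * f y ∂(ringMeasure L)‖ₑ ^ 2 ≤
        2 * (K * ∑ m ∈ (Finset.Icc 1 L).filter (fun m => natTorusDist L n m < R), h n m x * F m +
          L * ∑ m ∈ (Finset.Icc 1 L).filter (fun m => ¬ natTorusDist L n m < R),
            h n m x * F m) := by
    intro n hn x hx
    set c : ℕ → ℝ≥0∞ := fun m => ∫⁻ y in cell m, G n m x y * ‖f y‖ₑ with hc
    have h1 : ‖∫ y, k x y * f y ∂(ringMeasure L)‖ₑ ≤ ∑ m ∈ Finset.Icc 1 L, c m := by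
      refine (enorm_integral_le_lintegral_enorm _).trans ?_
      rw [lintegral_ringMeasure]
      refine Finset.sum_le_sum fun m hm => ?_
      refine setLIntegral_mono' (measurableSet_cell m) fun y hy => ?_
      rw [enorm_mul]
      gcongr
      exact hGk n hn m hm x hx y hy
    have h2 : ∀ m ∈ Finset.Icc 1 L, c m ^ 2 ≤ h n m x * F m := by
      intro m hm
      exact lintegral_mul_sq_le
        ((hGm n hn m hm).comp measurable_prodMk_left).aemeasurable (hfcell m hm)
    have h3 : ∀ (s : Finset ℕ) (B : ℕ), s ⊆ Finset.Icc 1 L → s.card ≤ B →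
        (∑ m ∈ s, c m) ^ 2 ≤ B * ∑ m ∈ s, h n m x * F m := by
      intro s B hs hB
      refine (ennreal_sq_sum_le s c).trans ?_
      gcongr with m hm
      exact h2 m (hs hm)
    calc _ ≤ (∑ m ∈ Finset.Icc 1 L, c m) ^ 2 := pow_le_pow_left' h1 2
      _ = (∑ m ∈ (Finset.Icc 1 L).filter (fun m => natTorusDist L n m < R), c m +
          ∑ m ∈ (Finset.Icc 1 L).filter (fun m => ¬ natTorusDist L n m < R), c m) ^ 2 := by
          rw [Finset.sum_filter_add_sum_filter_not]
      _ ≤ _ := by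
          refine (ennreal_add_sq_le _ _).trans ?_
          gcongr
          · exact h3 _ K (Finset.filter_subset _ _) (hK n hn)
          · refine h3 _ L (Finset.filter_subset _ _) ((Finset.card_filter_le _ _).trans ?_)
            simp
  have hhm : ∀ n ∈ Finset.Icc 1 L, ∀ m ∈ Finset.Icc 1 L, Measurable (h n m) := fun n hn m hm =>
    ((hGm n hn m hm).pow_const 2).lintegral_prod_right'
  have hblock : ∀ n ∈ Finset.Icc 1 L,
      ∫⁻ x in cell n, ‖∫ y, k x y * f y ∂(ringMeasure L)‖ₑ ^ 2 ≤
        2 * (K * ∑ m ∈ (Finset.Icc 1 L).filter (fun m => natTorusDist L n m < R), ρ ^ 2 * F m +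
          L * ∑ m ∈ Finset.Icc 1 L, η ^ 2 * F m) := by
    intro n hn
    have hint : ∀ s ⊆ Finset.Icc 1 L, ∫⁻ x in cell n, ∑ m ∈ s, h n m x * F m =
        ∑ m ∈ s, (∫⁻ x in cell n, h n m x) * F m := by
      intro s hs
      rw [lintegral_finsetSum' _ fun m hm => ((hhm n hn m (hs hm)).mul_const _).aemeasurable]
      exact Finset.sum_congr rfl fun m hm => lintegral_mul_const _ (hhm n hn m (hs hm))
    have hms : ∀ s ⊆ Finset.Icc 1 L, Measurable fun x => ∑ m ∈ s, h n m x * F m := fun s hs =>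
      Finset.measurable_sum s fun m hm => (hhm n hn m (hs hm)).mul_const _
    refine (setLIntegral_mono' (measurableSet_cell n) (hpoint n hn)).trans ?_
    rw [lintegral_const_mul' _ _ (by norm_num),
      lintegral_add_left ((hms _ (Finset.filter_subset _ _)).const_mul _),
      lintegral_const_mul' _ _ (by simp), lintegral_const_mul' _ _ (by simp),
      hint _ (Finset.filter_subset _ _), hint _ (Finset.filter_subset _ _)]
    gcongr 2 * (K * ?_ + L * ?_)
    · refine Finset.sum_le_sum fun m hm => ?_
      rw [Finset.mem_filter] at hm
      have := hGi n hn m hm.1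
      rw [if_pos hm.2] at this
      gcongr
    · refine (Finset.sum_le_sum fun m hm => ?_).trans
        (Finset.sum_le_sum_of_subset (Finset.filter_subset _ _))
      rw [Finset.mem_filter] at hm
      have := hGi n hn m hm.1
      rw [if_neg hm.2] at this
      gcongr
  -- The second factor `K`: by symmetry of the distance, each `F m` is counted for at most `K` cells
  -- `n`.
  have hnear : ∑ n ∈ Finset.Icc 1 L,
      ∑ m ∈ (Finset.Icc 1 L).filter (fun m => natTorusDist L n m < R), ρ ^ 2 * F m ≤
        K * ρ ^ 2 := by
    simp only [Finset.sum_filter]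
    rw [Finset.sum_comm]
    calc _ ≤ ∑ m ∈ Finset.Icc 1 L, K * ρ ^ 2 * F m := by
          refine Finset.sum_le_sum fun m hm => ?_
          rw [← Finset.sum_filter, Finset.sum_const, nsmul_eq_mul, ← mul_assoc]
          gcongr
          simp only [natTorusDist_comm L _ m]
          exact hK m hm
      _ ≤ K * ρ ^ 2 := by
          rw [← Finset.mul_sum]
          exact mul_le_of_le_one_right' hFsum
  have hfar : ∑ _n ∈ Finset.Icc 1 L, ∑ m ∈ Finset.Icc 1 L, η ^ 2 * F m ≤ L * η ^ 2 := by
    rw [Finset.sum_const, nsmul_eq_mul, Nat.card_Icc, Nat.add_sub_cancel, ← Finset.mul_sum]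
    gcongr
    exact mul_le_of_le_one_right' hFsum
  calc _ ≤ ∑ n ∈ Finset.Icc 1 L, 2 * (K * ∑ m ∈ (Finset.Icc 1 L).filter
          (fun m => natTorusDist L n m < R), ρ ^ 2 * F m +
          L * ∑ m ∈ Finset.Icc 1 L, η ^ 2 * F m) := Finset.sum_le_sum hblock
    _ ≤ 2 * (K * (K * ρ ^ 2) + L * (L * η ^ 2)) := by
        rw [← Finset.mul_sum, Finset.sum_add_distrib, ← Finset.mul_sum, ← Finset.mul_sum]
        gcongr
    _ ≤ 2 * (K * (K * ρ ^ 2) + L * (L * η ^ 2)) +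
        (2 * (K * (K * ρ ^ 2) + L * (L * η ^ 2)) + 8 * (K * ρ) * (L * η)) := le_self_add
    _ = (2 * (K * ρ + L * η)) ^ 2 := by ring

end BlockKernel

/-! ### Off-diagonal decay of the reduced density matrix of localized functions. -/

section Decay

variable {L k : ℕ} {f : Fin (k + 1) → ℝ → ℂ}

/-- Entries of the adjugate weight matrix are small if they couple functions centered near the
cell `n` to functions centered elsewhere, when `n` is far from `m`. -/
theorem IsOrthonormalOn.enorm_adjugate_le (hf : IsOrthonormalOn L f) {D n m : ℕ}
    (hn : n ∈ Finset.Icc 1 L) (hm : m ∈ Finset.Icc 1 L) (hnm : 4 * D ≤ natTorusDist L n m)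
    {κ : ℝ≥0} {c : Fin (k + 1) → ℕ} (hc : ∀ a, c a ∈ Finset.Icc 1 L)
    (hκ : ∀ a, ∀ t ∈ Finset.Icc 1 L, D ≤ natTorusDist L (c a) t → cellNorm (f a) t ≤ κ)
    {x y : ℝ} (hx : x ∈ cell n) (hy : y ∈ cell m) {a b : Fin (k + 1)}
    (ha : natTorusDist L (c a) n < D) (hb : ¬ natTorusDist L (c b) n < D) :
    ‖(weightMatrix (ringMeasure L) f (signWeight x y)).adjugate b a‖ₑ ≤
      (k : ℝ≥0∞) ^ 2 * (2 * L * κ) := by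
  have hw := measurable_signWeight x y
  have hw1 := norm_signWeight_le_one x y
  -- The decoupling: a function `j` centered near `n` against a function `i` centered elsewhere.
  have hM : ∀ i j, natTorusDist L (c j) n < D → ¬ natTorusDist L (c i) n < D →
      ‖weightMatrix (ringMeasure L) f (signWeight x y) i j‖ₑ ≤ 2 * L * κ := by
    intro i j hj hi
    have hij : i ≠ j := by
      rintro rfl
      exact hi hj
    by_cases him : natTorusDist L (c i) m < D
    · refine hf.enorm_weightMatrix_le hw hw1 hij (c := 0) (by simp) fun t ht => Or.inr ?_
      by_cases hit : D ≤ natTorusDist L (c i) t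
      · exact mul_le_of_le_of_le_one (hκ i t ht hit) (hf.cellNorm_le_one j ht)
      -- The center of `i` is near `m`, that of `j` near `n`, and `n`, `m` are `4 * D` apart. So no
      -- cell is within `D` of both centers.
      · have h1 := natTorusDist_triangle hn hm (hc i)
        have h2 := natTorusDist_triangle hn (hc i) (hc j)
        have h3 := natTorusDist_triangle (hc j) (hc i) ht
        rw [natTorusDist_comm L n (c j)] at h2
        rw [natTorusDist_comm L t (c i)] at h3
        exact mul_le_of_le_one_of_le (hf.cellNorm_le_one i ht) (hκ j t ht (by omega))
    -- The center of `i` is far from both `n` and `m`: within distance `D` of it the weight is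
    -- constant, and beyond that `f i` is small.
    · refine hf.enorm_weightMatrix_le hw hw1 hij
        (c := ((cellSign n (c i) * cellSign m (c i) : ℝ) : ℂ)) ?_ fun t ht => ?_
      · rw [Complex.norm_real, Real.norm_eq_abs, abs_mul, abs_cellSign, abs_cellSign, one_mul]
      · by_cases hit : D ≤ natTorusDist L (c i) t
        · exact Or.inr (mul_le_of_le_of_le_one (hκ i t ht hit) (hf.cellNorm_le_one j ht))
        · left
          intro z hz
          obtain ⟨h1, h2, h3⟩ := cellSign_mul_cellSign_eq hn hm (hc i) ht (not_lt.1 hi)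
            (not_lt.1 him) (not_le.1 hit)
          rw [← h3, signWeight, sign_sub_eq_cellSign h1 hx hz, sign_sub_eq_cellSign h2 hy hz]
  have hε : (2 * L * κ : ℝ≥0∞) = ((2 * L * κ : ℝ≥0) : ℝ≥0∞) := by push_cast; rfl
  have h := norm_adjugate_le_of_decoupled (hf.sum_norm_sq_weightMatrix_le hw hw1)
    (Finset.univ.filter fun a => natTorusDist L (c a) n < D) (ε := (2 * L * κ : ℝ≥0))
    (NNReal.coe_nonneg _) (a := a) (b := b) (fun i j hi hj => by
      simp only [Finset.mem_filter, Finset.mem_univ, true_and] at hi hj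
      have := hM i j hj hi
      rw [hε, enorm_le_coe] at this
      exact_mod_cast this) (by simpa using ha) (by simpa using hb)
  have h2 : ((k : ℝ≥0∞) ^ 2 * (2 * L * κ)) = (((k : ℝ≥0) ^ 2 * (2 * L * κ) : ℝ≥0) : ℝ≥0∞) := by
    push_cast; rfl
  rw [h2, enorm_le_coe]
  exact_mod_cast h

/-- Far off-diagonal blocks of the reduced density matrix of a system of localized functions are
small. -/
theorem IsOrthonormalOn.exists_majorant_far (hf : IsOrthonormalOn L f) {D n m : ℕ}
    (hn : n ∈ Finset.Icc 1 L) (hm : m ∈ Finset.Icc 1 L) (hnm : 4 * D ≤ natTorusDist L n m)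
    {δ : ℝ≥0} (hδ : ∀ a, ∀ i ∈ Finset.Icc 1 L, ∀ j ∈ Finset.Icc 1 L, D ≤ natTorusDist L i j →
      cellNorm (f a) i * cellNorm (f a) j ≤ δ) :
    ∃ G : ℝ → ℝ → ℝ≥0∞, Measurable (Function.uncurry G) ∧
      (∀ x ∈ cell n, ∀ y ∈ cell m, ‖reducedDensity L (bosonState f) x y‖ₑ ≤ G x y) ∧
      ∫⁻ x in cell n, ∫⁻ y in cell m, G x y ^ 2 ≤
        (((k : ℝ≥0∞) + 1) ^ 4 * (2 * L ^ 2 * δ)) ^ 2 := by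
  have hL : 1 ≤ L := (Finset.mem_Icc.1 hn).1.trans (Finset.mem_Icc.1 hn).2
  have hL' : (1 : ℝ≥0∞) ≤ L := by exact_mod_cast hL
  choose c hc hc1 using hf.exists_center
  -- Smallness of products becomes smallness away from the center, at the cost of a factor `L`,
  -- because `1 ≤ L Φ(c)²` at the center `c`.
  have hκ : ∀ a, ∀ t ∈ Finset.Icc 1 L, D ≤ natTorusDist L (c a) t →
      cellNorm (f a) t ≤ (L * δ : ℝ≥0) := by
    intro a t ht hD
    calc cellNorm (f a) t ≤ L * cellNorm (f a) (c a) ^ 2 * cellNorm (f a) t :=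
          le_mul_of_one_le_left' (hc1 a)
      _ = L * cellNorm (f a) (c a) * (cellNorm (f a) (c a) * cellNorm (f a) t) := by ring
      _ ≤ L * 1 * δ := by
          gcongr
          · exact hf.cellNorm_le_one a (hc a)
          · exact hδ a _ (hc a) t ht hD
      _ = (L * δ : ℝ≥0) := by push_cast; ring
  -- One bound for both sources of smallness, the tails `L * δ` and the adjugate entries; `k + 1`
  -- instead of `k` keeps it valid for `k = 0`.
  set e : ℝ≥0∞ := ((k : ℝ≥0∞) + 1) ^ 2 * (2 * L ^ 2 * δ) with he
  have hκe : ((L * δ : ℝ≥0) : ℝ≥0∞) ≤ e := by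
    calc ((L * δ : ℝ≥0) : ℝ≥0∞) = 1 ^ 2 * (1 * (L * 1) * δ) := by push_cast; ring
      _ ≤ (k + 1) ^ 2 * (2 * (L * L) * δ) := by
          gcongr
          · exact le_add_self
          · norm_num
      _ = e := by rw [he]; ring
  have hke : (k : ℝ≥0∞) ^ 2 * (2 * L * (L * δ : ℝ≥0)) ≤ e := by
    calc (k : ℝ≥0∞) ^ 2 * (2 * L * (L * δ : ℝ≥0)) = k ^ 2 * (2 * L ^ 2 * δ) := by push_cast; ring
      _ ≤ e := by
          rw [he]
          gcongr
          exact le_self_add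
  set C : Fin (k + 1) → Fin (k + 1) → ℝ≥0∞ := fun a b =>
    if natTorusDist L (c a) n < D ∧ ¬ natTorusDist L (c b) n < D then e else 1 with hC
  -- If `a` is centered near `n` and `b` is not, the adjugate entry is small. If both are centered
  -- near `n`, `f b` is small on the cell `m`; if `a` is not, `f a` is small on the cell `n`.
  have hCe : ∀ a b, C a b * (cellNorm (f a) n * cellNorm (f b) m) ≤ e := by
    intro a b
    simp only [hC]
    split_ifs with h
    · exact mul_le_of_le_one_right' (mul_le_one' (hf.cellNorm_le_one a hn)
        (hf.cellNorm_le_one b hm))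
    · rw [one_mul]
      by_cases h1 : natTorusDist L (c a) n < D
      · have h2 : natTorusDist L (c b) n < D := by
          by_contra h3
          exact h ⟨h1, h3⟩
        have h3 := natTorusDist_triangle hn hm (hc b)
        rw [natTorusDist_comm L n (c b)] at h3
        exact (mul_le_of_le_one_of_le (hf.cellNorm_le_one a hn)
          (hκ b m hm (by omega))).trans hκe
      · exact (mul_le_of_le_of_le_one (hκ a n hn (not_lt.1 h1)) (hf.cellNorm_le_one b hm)).trans hκe
  have hmeas := hf.measurable
  refine ⟨fun x y => ∑ p : Fin (k + 1) × Fin (k + 1), C p.1 p.2 * (‖f p.1 x‖ₑ * ‖f p.2 y‖ₑ),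
    ?_, ?_, ?_⟩
  · unfold Function.uncurry
    fun_prop
  · intro x hx y hy
    rw [reducedDensity_bosonState hf, ← Fintype.sum_prod_type']
    refine (enorm_sum_le _ _).trans (Finset.sum_le_sum fun p _ => ?_)
    rw [enorm_mul, enorm_mul, RCLike.enorm_conj, mul_comm]
    gcongr
    simp only [hC]
    split_ifs with h
    · exact (hf.enorm_adjugate_le hn hm hnm hc hκ hx hy h.1 h.2).trans hke
    · have h1 := norm_adjugate_le_one (hf.sum_norm_sq_weightMatrix_le
        (measurable_signWeight x y) (norm_signWeight_le_one x y)) p.1 p.2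
      rw [← ofReal_norm, ← ENNReal.ofReal_one]
      exact ENNReal.ofReal_le_ofReal h1
  · have hcard : ((Finset.univ : Finset (Fin (k + 1) × Fin (k + 1))).card : ℝ≥0∞) =
        ((k : ℝ≥0∞) + 1) ^ 2 := by
      rw [Finset.card_univ, Fintype.card_prod, Fintype.card_fin]
      push_cast
      ring
    have hterm : ∀ p : Fin (k + 1) × Fin (k + 1), ∫⁻ x in cell n, ∫⁻ y in cell m,
        (C p.1 p.2 * (‖f p.1 x‖ₑ * ‖f p.2 y‖ₑ)) ^ 2 =
        (C p.1 p.2 * (cellNorm (f p.1) n * cellNorm (f p.2) m)) ^ 2 := by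
      intro p
      simp only [mul_pow, cellNorm_sq]
      have h1 : Measurable fun x => ‖f p.1 x‖ₑ ^ 2 := by fun_prop
      have h2 : Measurable fun x => ‖f p.2 x‖ₑ ^ 2 := by fun_prop
      have h3 : ∀ x, ∫⁻ y in cell m, C p.1 p.2 ^ 2 * (‖f p.1 x‖ₑ ^ 2 * ‖f p.2 y‖ₑ ^ 2) =
          C p.1 p.2 ^ 2 * (‖f p.1 x‖ₑ ^ 2 * ∫⁻ y in cell m, ‖f p.2 y‖ₑ ^ 2) := by
        intro x
        rw [lintegral_const_mul _ (h2.const_mul _), lintegral_const_mul _ h2]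
      simp only [h3]
      rw [lintegral_const_mul _ (h1.mul_const _), lintegral_mul_const _ h1]
    calc _ ≤ ∫⁻ x in cell n, ∫⁻ y in cell m, ((k : ℝ≥0∞) + 1) ^ 2 *
          ∑ p : Fin (k + 1) × Fin (k + 1), (C p.1 p.2 * (‖f p.1 x‖ₑ * ‖f p.2 y‖ₑ)) ^ 2 := by
          refine lintegral_mono fun x => lintegral_mono fun y => ?_
          rw [← hcard]
          exact ennreal_sq_sum_le _ _
      _ = ((k : ℝ≥0∞) + 1) ^ 2 * ∑ p : Fin (k + 1) × Fin (k + 1),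
          (C p.1 p.2 * (cellNorm (f p.1) n * cellNorm (f p.2) m)) ^ 2 := by
          have h1 : ∀ x, ∫⁻ y in cell m, ((k : ℝ≥0∞) + 1) ^ 2 *
              ∑ p : Fin (k + 1) × Fin (k + 1), (C p.1 p.2 * (‖f p.1 x‖ₑ * ‖f p.2 y‖ₑ)) ^ 2 =
              ((k : ℝ≥0∞) + 1) ^ 2 * ∑ p : Fin (k + 1) × Fin (k + 1),
                ∫⁻ y in cell m, (C p.1 p.2 * (‖f p.1 x‖ₑ * ‖f p.2 y‖ₑ)) ^ 2 := by
            intro x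
            rw [lintegral_const_mul _ (by fun_prop), lintegral_finsetSum _ fun p _ => by fun_prop]
          simp only [h1]
          have h2 : ∀ p : Fin (k + 1) × Fin (k + 1), Measurable fun x =>
              ∫⁻ y in cell m, (C p.1 p.2 * (‖f p.1 x‖ₑ * ‖f p.2 y‖ₑ)) ^ 2 := fun p =>
            Measurable.lintegral_prod_right' (f := fun q : ℝ × ℝ =>
              (C p.1 p.2 * (‖f p.1 q.1‖ₑ * ‖f p.2 q.2‖ₑ)) ^ 2) (by fun_prop)
          rw [lintegral_const_mul _ (Finset.measurable_sum _ fun p _ => h2 p),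
            lintegral_finsetSum _ fun p _ => h2 p]
          simp only [hterm]
      _ ≤ ((k : ℝ≥0∞) + 1) ^ 2 * ∑ _p : Fin (k + 1) × Fin (k + 1), e ^ 2 := by
          gcongr with p
          exact hCe p.1 p.2
      _ = _ := by
          rw [Finset.sum_const, nsmul_eq_mul, hcard, he]
          ring

/-- Blocks of the reduced density matrix are bounded by the local particle numbers. -/
theorem IsOrthonormalOn.exists_majorant (hf : IsOrthonormalOn L f) {n m : ℕ} {ρ : ℝ≥0∞}
    (hn : ∑ a, cellNorm (f a) n ^ 2 ≤ ρ) (hm : ∑ a, cellNorm (f a) m ^ 2 ≤ ρ) :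
    ∃ G : ℝ → ℝ → ℝ≥0∞, Measurable (Function.uncurry G) ∧
      (∀ x ∈ cell n, ∀ y ∈ cell m, ‖reducedDensity L (bosonState f) x y‖ₑ ≤ G x y) ∧
      ∫⁻ x in cell n, ∫⁻ y in cell m, G x y ^ 2 ≤ ρ ^ 2 := by
  have hmeas := hf.measurable
  set u : ℝ → ℝ≥0∞ := fun x => ENNReal.ofReal (Real.sqrt (∑ a, ‖f a x‖ ^ 2)) with hu
  have hum : Measurable u := by fun_prop
  have husq : ∀ x, u x ^ 2 = ∑ a, ‖f a x‖ₑ ^ 2 := by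
    intro x
    simp only [hu]
    rw [← ENNReal.ofReal_pow (Real.sqrt_nonneg _), Real.sq_sqrt (by positivity),
      ENNReal.ofReal_sum_of_nonneg fun a _ => by positivity]
    refine Finset.sum_congr rfl fun a _ => ?_
    rw [ENNReal.ofReal_pow (norm_nonneg _), ofReal_norm]
  have hint : ∀ n, ∫⁻ x in cell n, u x ^ 2 = ∑ a, cellNorm (f a) n ^ 2 := by
    intro n
    simp only [husq, cellNorm_sq]
    exact lintegral_finsetSum _ fun a _ => by fun_prop
  refine ⟨fun x y => u x * u y, ?_, fun x _ y _ => ?_, ?_⟩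
  · unfold Function.uncurry
    fun_prop
  · simp only [hu]
    rw [← ofReal_norm, ← ENNReal.ofReal_mul (Real.sqrt_nonneg _)]
    exact ENNReal.ofReal_le_ofReal (norm_reducedDensity_le hf x y)
  · have h1 : ∀ x, ∫⁻ y in cell m, (u x * u y) ^ 2 = u x ^ 2 * ∫⁻ y in cell m, u y ^ 2 := by
      intro x
      simp only [mul_pow]
      rw [lintegral_const_mul _ (by fun_prop)]
    simp only [h1]
    rw [lintegral_mul_const _ (by fun_prop), hint, hint, sq]
    gcongr

end Decay

/-- Bound on the norm of the reduced density matrix of a system of localized functions. -/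
theorem IsOrthonormalOn.kernelNorm_reducedDensity_le {L N : ℕ} {f : Fin N → ℝ → ℂ}
    (hf : IsOrthonormalOn L f) {D : ℕ} (hD : 1 ≤ D) {δ : ℝ≥0} {ρ : ℝ≥0∞}
    (hδ : ∀ a, ∀ i ∈ Finset.Icc 1 L, ∀ j ∈ Finset.Icc 1 L, D ≤ natTorusDist L i j →
      cellNorm (f a) i * cellNorm (f a) j ≤ δ)
    (hρ : ∀ n ∈ Finset.Icc 1 L, ∑ a, cellNorm (f a) n ^ 2 ≤ ρ) :
    kernelNorm L (reducedDensity L (bosonState f)) ≤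
      2 * (17 * D * ρ + L * ((L * ρ) ^ 4 * (2 * L ^ 2 * δ))) := by
  -- Adding up the local numbers counts every normalized function once; this removes the particle
  -- number from the bound.
  have hN : (N : ℝ≥0∞) ≤ L * ρ := by
    calc (N : ℝ≥0∞) = ∑ a : Fin N, ∑ n ∈ Finset.Icc 1 L, cellNorm (f a) n ^ 2 := by
          simp [hf.sum_cellNorm_sq]
      _ = ∑ n ∈ Finset.Icc 1 L, ∑ a, cellNorm (f a) n ^ 2 := Finset.sum_comm
      _ ≤ ∑ n ∈ Finset.Icc 1 L, ρ := Finset.sum_le_sum hρ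
      _ = L * ρ := by simp
  cases N with
  | zero =>
    have : kernelNorm L (reducedDensity L (bosonState f)) = 0 := by
      simp [kernelNorm, reducedDensity]
    rw [this]
    exact zero_le
  | succ k =>
    have h := kernelNorm_le (L := L) (R := 4 * D) (K := 17 * D)
      (k := reducedDensity L (bosonState f)) (ρ := ρ)
      (η := ((k : ℝ≥0∞) + 1) ^ 4 * (2 * L ^ 2 * δ))
      (fun n hn => card_filter_natTorusDist_lt hD (Finset.mem_Icc.1 hn).2)
      fun n hn m hm => by
        split_ifs with hnm
        · exact hf.exists_majorant (hρ n hn) (hρ m hm)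
        · exact hf.exists_majorant_far hn hm (not_lt.1 hnm) hδ
    refine h.trans ?_
    push_cast at hN ⊢
    gcongr

/-! ### Eigenbases, spectral projections and correlators. -/

section Eigenbasis

variable {V : ℝ → ℝ} {L : ℕ} {s : ℤˣ} {E : ℕ → ℝ} {f : ℕ → ℝ → ℂ}

/-- On `[0, L]` such a function is a constant plus the continuous primitive of an integrable
function, hence bounded. -/
theorem IsSobolev.memLp_self {u v : ℝ → ℂ} (h : IsSobolev L s u v) (hu : Measurable u) :
    MemLp u 2 (ringMeasure L) := by
  have hL : (0 : ℝ) ≤ L := Nat.cast_nonneg L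
  have hint : IntervalIntegrable v volume 0 L := by
    rw [intervalIntegrable_iff_integrableOn_Ioc_of_le hL]
    exact h.memLp.integrable (by norm_num)
  have hcont := intervalIntegral.continuousOn_primitive_interval' hint left_mem_uIcc
  obtain ⟨B, hB⟩ := isCompact_uIcc.exists_bound_of_continuousOn hcont
  refine MemLp.of_bound hu.aestronglyMeasurable (‖u 0‖ + B) ?_
  refine (ae_restrict_iff' measurableSet_Ioc).2 (Eventually.of_forall fun x hx => ?_)
  rw [h.eq_integral x (Ioc_subset_Icc_self hx)]
  refine (norm_add_le _ _).trans ?_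
  gcongr
  refine hB x ?_
  rw [uIcc_of_le hL]
  exact Ioc_subset_Icc_self hx

theorem IsEigenbasis.memLp (h : IsEigenbasis V L s E f) (hf : ∀ j, Measurable (f j)) (j : ℕ) :
    MemLp (f j) 2 (ringMeasure L) := by
  obtain ⟨g, hg, -⟩ := h.eigen j
  exact hg.memLp_self (hf j)

theorem intervalIntegral_eq_ringMeasure (L : ℕ) (g : ℝ → ℂ) :
    ∫ x in (0 : ℝ)..L, g x = ∫ x, g x ∂(ringMeasure L) :=
  intervalIntegral.integral_of_le (Nat.cast_nonneg L)

theorem IsEigenbasis.isOrthonormalOn (h : IsEigenbasis V L s E f) (hf : ∀ j, Measurable (f j))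
    {N : ℕ} {sel : Fin N → ℕ} (hsel : Function.Injective sel) :
    IsOrthonormalOn L fun a => f (sel a) where
  measurable a := hf _
  memLp a := h.memLp hf _
  orthonormal a b := by
    rw [← intervalIntegral_eq_ringMeasure, h.orthonormal]
    simp [hsel.eq_iff]

/-- The Hilbert basis of eigenfunctions. -/
theorem IsEigenbasis.exists_hilbertBasis (h : IsEigenbasis V L s E f)
    (hf : ∀ j, Measurable (f j)) :
    ∃ b : HilbertBasis ℕ ℂ (L2 L), ∀ j, b j = (h.memLp hf j).toLp := by
  have hinner : ∀ (j : ℕ) (v : L2 L),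
      inner ℂ (h.memLp hf j).toLp v = ∫ x in (0 : ℝ)..L, conj (f j x) * v x := by
    intro j v
    rw [intervalIntegral_eq_ringMeasure, L2.inner_def]
    refine integral_congr_ae ?_
    filter_upwards [(h.memLp hf j).coeFn_toLp] with t h1
    rw [h1, RCLike.inner_apply, mul_comm]
  have ho : Orthonormal ℂ fun j => (h.memLp hf j).toLp := by
    rw [orthonormal_iff_ite]
    intro i j
    rw [hinner, ← h.orthonormal i j, intervalIntegral_eq_ringMeasure,
      intervalIntegral_eq_ringMeasure]
    refine integral_congr_ae ?_
    filter_upwards [(h.memLp hf j).coeFn_toLp] with t h1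
    rw [h1]
  have hbot : (Submodule.span ℂ (Set.range fun j => (h.memLp hf j).toLp))ᗮ = ⊥ := by
    rw [Submodule.eq_bot_iff]
    intro v hv
    rw [Submodule.mem_orthogonal] at hv
    refine (Lp.eq_zero_iff_ae_eq_zero).2 (h.complete v (Lp.memLp v) fun j => ?_)
    rw [← hinner]
    exact hv _ (Submodule.subset_span ⟨j, rfl⟩)
  exact ⟨HilbertBasis.mkOfOrthogonalEqBot ho hbot, fun j => by
    rw [HilbertBasis.coe_mkOfOrthogonalEqBot]⟩

theorem spectralProjection_eq_self {J : Set ℝ} {e : ℝ} (he : e ∈ J) {g : ℝ → ℂ}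
    (hg : IsEigenfunction V L s e g) (hgm : MemLp g 2 (ringMeasure L)) :
    spectralProjection V L s J hgm.toLp = hgm.toLp := by
  unfold spectralProjection
  have : CompleteSpace (spectralSubspace V L s J) :=
    (Submodule.isClosed_topologicalClosure _).completeSpace_coe
  refine Submodule.starProjection_eq_self_iff.2 ?_
  exact Submodule.le_topologicalClosure _ (Submodule.subset_span ⟨e, he, g, hg, hgm.coeFn_toLp⟩)

/-- The diagonal of the eigenfunction correlator is bounded by the local particle number. -/
theorem IsEigenbasis.correlator_le_localNumber (h : IsEigenbasis V L s E f)
    (hf : ∀ j, Measurable (f j)) (J : Set ℝ) {n : ℕ} (h1 : 1 ≤ n) (h2 : n ≤ L) :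
    correlator J E f n n ≤ localNumber V L s J n := by
  classical
  obtain ⟨b, hb⟩ := h.exists_hilbertBasis hf
  have hμ : (ringMeasure L).restrict (cell n) = volume.restrict (cell n) := by
    unfold ringMeasure
    rw [Measure.restrict_restrict (measurableSet_cell n),
      inter_eq_self_of_subset_left (cell_subset h1 h2)]
  -- The supremum is tested on the eigenbasis itself: the projection fixes the eigenfunctions with
  -- energy in `J`, and the other nonnegative terms are discarded.
  refine le_trans ?_ (le_iSup _ b)
  refine ENNReal.tsum_le_tsum fun j => ?_
  split_ifs with hj
  · rw [hb, spectralProjection_eq_self hj (h.eigen j), ← sq, cellNorm_sq, ← hμ]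
    refine le_of_eq (lintegral_congr_ae ?_)
    filter_upwards [ae_restrict_of_ae (h.memLp hf j).coeFn_toLp] with x hx
    rw [hx]
  · exact zero_le

/-- Distinct indices form a subfamily of the nonnegative series over `J`. The bound is thus uniform
over selections, which may depend on the randomness in an arbitrary way. -/
theorem sum_cellNorm_mul_le_correlator {J : Set ℝ} {N : ℕ} {sel : Fin N → ℕ}
    (hsel : Function.Injective sel) (hJ : ∀ a, E (sel a) ∈ J) (n m : ℕ) :
    ∑ a, cellNorm (f (sel a)) n * cellNorm (f (sel a)) m ≤ correlator J E f n m := by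
  classical
  unfold correlator
  refine le_trans (le_of_eq ?_) (ENNReal.tsum_comp_le_tsum_of_injective hsel _)
  rw [tsum_fintype]
  exact Finset.sum_congr rfl fun a _ => (if_pos (hJ a)).symm

end Eigenbasis

/-! ### Measurability and Borel--Cantelli. -/

section Probability

variable {Ω : Type*} [MeasurableSpace Ω]

theorem measurable_cellNorm {g : Ω → ℝ → ℂ} (hg : Measurable (Function.uncurry g)) (n : ℕ) :
    Measurable fun ω => cellNorm (g ω) n := by
  unfold cellNorm
  have h : Measurable fun q : Ω × ℝ => ‖g q.1 q.2‖ₑ ^ 2 := hg.enorm.pow_const 2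
  exact (h.lintegral_prod_right' (ν := volume.restrict (cell n))).pow_const _

theorem measurable_correlator {J : Set ℝ} (hJ : MeasurableSet J) {E : ℕ → Ω → ℝ}
    {φ : ℕ → Ω → ℝ → ℂ} (hE : ∀ j, Measurable (E j))
    (hφ : ∀ j, Measurable (Function.uncurry (φ j))) (n m : ℕ) :
    Measurable fun ω => correlator J (fun j => E j ω) (fun j => φ j ω) n m := by
  classical
  unfold correlator
  refine Measurable.tsum fun j => ?_
  exact Measurable.ite (hE j hJ)
    ((measurable_cellNorm (hφ j) n).mul (measurable_cellNorm (hφ j) m)) measurable_const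

/-- A Borel--Cantelli lemma for nonnegative random variables with summable expectations. -/
theorem ae_eventually_le_one {P : Measure Ω} {X : ℕ → Ω → ℝ≥0∞} (hX : ∀ L, Measurable (X L))
    {b : ℕ → ℝ} (hb : Summable b) (hXb : ∀ L, ∫⁻ ω, X L ω ∂P ≤ ENNReal.ofReal (b L)) :
    ∀ᵐ ω ∂P, ∀ᶠ L in atTop, X L ω ≤ 1 := by
  have h1 : ∫⁻ ω, ∑' L, X L ω ∂P ≠ ⊤ := by
    rw [lintegral_tsum fun L => (hX L).aemeasurable]
    exact ne_top_of_le_ne_top hb.tsum_ofReal_ne_top (ENNReal.tsum_le_tsum hXb)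
  filter_upwards [ae_lt_top (Measurable.tsum hX) h1] with ω hω
  have h2 := ENNReal.tendsto_atTop_zero_of_tsum_ne_top hω.ne
  exact h2.eventually (Iic_mem_nhds one_pos)

/-- In the variable `y = L ^ a`, the power `L ^ (k + 2)` is `y ^ ((k + 2) / a)`, which `exp (-(c *
y))` beats. So the terms are eventually at most `L ^ (-2)`. -/
theorem summable_pow_mul_exp_neg_rpow (k : ℕ) {a c : ℝ} (ha : 0 < a) (hc : 0 < c) :
    Summable fun L : ℕ => (L : ℝ) ^ k * Real.exp (-(c * (L : ℝ) ^ a)) := by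
  have hy : Tendsto (fun L : ℕ => (L : ℝ) ^ a) atTop atTop :=
    (tendsto_rpow_atTop ha).comp tendsto_natCast_atTop_atTop
  have h1 := (tendsto_rpow_mul_exp_neg_mul_atTop_nhds_zero ((k + 2 : ℕ) / a) c hc).comp hy
  have h2 : Summable fun L : ℕ => ((L : ℝ) ^ 2)⁻¹ := Real.summable_nat_pow_inv.2 (by norm_num)
  refine Summable.of_norm_bounded_eventually_nat h2 ?_
  filter_upwards [h1.eventually (Iic_mem_nhds one_pos), eventually_ge_atTop 1] with L hL hL1
  have hLpos : (0 : ℝ) < L := by exact_mod_cast hL1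
  simp only [Function.comp] at hL
  rw [← Real.rpow_mul hLpos.le, mul_div_cancel₀ _ ha.ne', Real.rpow_natCast] at hL
  rw [neg_mul, pow_add] at hL
  rw [Real.norm_of_nonneg (by positivity), ← one_div, le_div_iff₀ (by positivity)]
  calc _ = _ := by ring
    _ ≤ 1 := hL

end Probability

/-! ### Almost sure bounds on the correlators. -/

section AlmostSure

variable {Ω : Type*} [MeasurableSpace Ω] {P : Measure Ω} {V : Ω → ℝ → ℝ}
  {E : ℤˣ → ℕ → ℕ → Ω → ℝ} {φ : ℤˣ → ℕ → ℕ → Ω → ℝ → ℂ} {J : Set ℝ}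

/-- Almost surely, the local particle numbers grow at most like `L ^ q`, for every `q > 2 / p`. -/
theorem ae_eventually_correlator_diag_le
    (hE : ∀ s L j, Measurable (E s L j)) (hφ : ∀ s L j, Measurable (Function.uncurry (φ s L j)))
    (hbasis : ∀ᵐ ω ∂P, ∀ (s : ℤˣ) (L : ℕ), 1 ≤ L →
      IsEigenbasis (V ω) L s (fun j => E s L j ω) (fun j => φ s L j ω))
    (hJ : MeasurableSet J) {p : ℝ} (hp : 0 < p)
    (hmoment : ∃ K : ℝ≥0, ∀ (s : ℤˣ) (L n : ℕ), 1 ≤ n → n ≤ L →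
      ∫⁻ ω, localNumber (V ω) L s J n ^ p ∂P ≤ K)
    {q : ℝ} (hq : 2 / p < q) :
    ∀ᵐ ω ∂P, ∀ᶠ L : ℕ in atTop, ∀ s, ∀ n ∈ Finset.Icc 1 L,
      correlator J (fun j => E s L j ω) (fun j => φ s L j ω) n n ≤
        ENNReal.ofReal ((L : ℝ) ^ q) := by
  obtain ⟨K, hK⟩ := hmoment
  have hpq : 2 < p * q := by
    rw [div_lt_iff₀ hp] at hq
    linarith
  -- Borel--Cantelli is applied to the correlator, which is measurable; the local number serves only
  -- as an almost sure majorant under the integral.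
  set Q : ℤˣ → ℕ → ℕ → Ω → ℝ≥0∞ := fun s L n ω =>
    correlator J (fun j => E s L j ω) (fun j => φ s L j ω) n n with hQ
  have hQm : ∀ s L n, Measurable (Q s L n) := fun s L n =>
    measurable_correlator hJ (hE s L) (hφ s L) n n
  -- Normalized so that `X L ω ≤ 1` forces every `Q` to be at most `L ^ q`. With `2 * L` terms the
  -- expectation is at most `2 K L ^ (1 - p q)`, which is summable precisely because `p q > 2`.
  set X : ℕ → Ω → ℝ≥0∞ := fun L ω => ∑ s : ℤˣ, ∑ n ∈ Finset.Icc 1 L,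
    Q s L n ω ^ p * ENNReal.ofReal ((L : ℝ) ^ (-(p * q))) with hX
  have hXm : ∀ L, Measurable (X L) := fun L =>
    Finset.measurable_sum _ fun s _ => Finset.measurable_sum _ fun n _ =>
      ((hQm s L n).pow_const p).mul_const _
  have hQK : ∀ s L, ∀ n ∈ Finset.Icc 1 L, ∫⁻ ω, Q s L n ω ^ p ∂P ≤ K := by
    intro s L n hn
    obtain ⟨h1, h2⟩ := Finset.mem_Icc.1 hn
    refine le_trans (lintegral_mono_ae ?_) (hK s L n h1 h2)
    filter_upwards [hbasis] with ω hω
    refine ENNReal.rpow_le_rpow ?_ hp.le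
    exact (hω s L (h1.trans h2)).correlator_le_localNumber
      (fun j => (hφ s L j).comp measurable_prodMk_left) J h1 h2
  have hsum : Summable fun L : ℕ => 2 * (K : ℝ) * ((L : ℝ) ^ (1 - p * q)) :=
    (Real.summable_nat_rpow.2 (by linarith)).mul_left _
  have hbound : ∀ L, ∫⁻ ω, X L ω ∂P ≤ ENNReal.ofReal (2 * (K : ℝ) * ((L : ℝ) ^ (1 - p * q))) := by
    intro L
    rcases Nat.eq_zero_or_pos L with rfl | hL
    · simp [hX]
    have hL' : (0 : ℝ) < L := by exact_mod_cast hL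
    calc ∫⁻ ω, X L ω ∂P = ∑ s : ℤˣ, ∑ n ∈ Finset.Icc 1 L,
          (∫⁻ ω, Q s L n ω ^ p ∂P) * ENNReal.ofReal ((L : ℝ) ^ (-(p * q))) := by
          simp only [hX]
          rw [lintegral_finsetSum _ fun s _ => Finset.measurable_sum _ fun n _ =>
            ((hQm s L n).pow_const p).mul_const _]
          refine Finset.sum_congr rfl fun s _ => ?_
          rw [lintegral_finsetSum _ fun n _ => ((hQm s L n).pow_const p).mul_const _]
          exact Finset.sum_congr rfl fun n _ => lintegral_mul_const _ ((hQm s L n).pow_const p)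
      _ ≤ ∑ _s : ℤˣ, ∑ _n ∈ Finset.Icc 1 L, K * ENNReal.ofReal ((L : ℝ) ^ (-(p * q))) := by
          gcongr with s _ n hn
          exact hQK s L n hn
      _ = 2 * K * (L * ENNReal.ofReal ((L : ℝ) ^ (-(p * q)))) := by
          rw [Finset.sum_const, Finset.sum_const, Finset.card_univ, Fintype.card_units_int,
            Nat.card_Icc, Nat.add_sub_cancel, nsmul_eq_mul, nsmul_eq_mul]
          push_cast
          ring
      _ = ENNReal.ofReal (2 * (K : ℝ) * ((L : ℝ) ^ (1 - p * q))) := by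
          rw [sub_eq_add_neg, Real.rpow_add hL', Real.rpow_one, ENNReal.ofReal_mul (by positivity),
            ENNReal.ofReal_mul (by positivity), ENNReal.ofReal_mul (by positivity)]
          simp
  filter_upwards [ae_eventually_le_one hXm hsum hbound] with ω hω
  filter_upwards [hω, eventually_ge_atTop 1] with L hL hL1 s n hn
  have hL' : (0 : ℝ) < L := by exact_mod_cast hL1
  have h1 : Q s L n ω ^ p * ENNReal.ofReal ((L : ℝ) ^ (-(p * q))) ≤ 1 := by
    refine le_trans ?_ hL
    refine le_trans ?_ (Finset.single_le_sum (f := fun s => ∑ n ∈ Finset.Icc 1 L,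
      Q s L n ω ^ p * ENNReal.ofReal ((L : ℝ) ^ (-(p * q)))) (fun _ _ => zero_le)
      (Finset.mem_univ s))
    exact Finset.single_le_sum (f := fun n => Q s L n ω ^ p *
      ENNReal.ofReal ((L : ℝ) ^ (-(p * q)))) (fun _ _ => zero_le) hn
  rw [Real.rpow_neg hL'.le, ENNReal.ofReal_inv_of_pos (by positivity), ← div_eq_mul_inv,
    ENNReal.div_le_iff_le_mul (Or.inl (by simp; positivity)) (Or.inl ENNReal.ofReal_ne_top),
    one_mul, mul_comm p q, Real.rpow_mul hL'.le,
    ← ENNReal.ofReal_rpow_of_nonneg (by positivity) hp.le] at h1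
  exact (ENNReal.rpow_le_rpow_iff hp).1 h1

/-- Almost surely, the eigenfunction correlator at distances `L ^ η` is smaller than any power
of `L`. -/
theorem ae_eventually_correlator_far_le
    (hE : ∀ s L j, Measurable (E s L j)) (hφ : ∀ s L j, Measurable (Function.uncurry (φ s L j)))
    (hJ : MeasurableSet J) (hloc : EigenfunctionCorrelatorLocalization P J E φ)
    {η : ℝ} (hη : 0 < η) (k : ℕ) :
    ∀ᵐ ω ∂P, ∀ᶠ L : ℕ in atTop, ∀ s, ∀ n ∈ Finset.Icc 1 L, ∀ m ∈ Finset.Icc 1 L,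
      ⌈(L : ℝ) ^ η⌉₊ ≤ natTorusDist L n m →
      L ^ k * correlator J (fun j => E s L j ω) (fun j => φ s L j ω) n m ≤ 1 := by
  obtain ⟨C, ℓ, ξ, hC, hℓ, hξ, -, hbd⟩ := hloc
  set Q : ℤˣ → ℕ → ℕ → ℕ → Ω → ℝ≥0∞ := fun s L n m ω =>
    correlator J (fun j => E s L j ω) (fun j => φ s L j ω) n m with hQ
  have hQm : ∀ s L n m, Measurable (Q s L n m) := fun s L n m =>
    measurable_correlator hJ (hE s L) (hφ s L) n m
  set c : ℝ := (ℓ ^ ξ)⁻¹ with hc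
  have hcpos : 0 < c := by positivity
  set X : ℕ → Ω → ℝ≥0∞ := fun L ω => ∑ s : ℤˣ, ∑ n ∈ Finset.Icc 1 L, ∑ m ∈ Finset.Icc 1 L,
    (if ⌈(L : ℝ) ^ η⌉₊ ≤ natTorusDist L n m then (L : ℝ≥0∞) ^ k * Q s L n m ω else 0) with hX
  have hterm : ∀ s (L n m : ℕ), Measurable fun ω =>
      (if ⌈(L : ℝ) ^ η⌉₊ ≤ natTorusDist L n m then (L : ℝ≥0∞) ^ k * Q s L n m ω else 0) := by
    intro s L n m
    split_ifs
    · exact (hQm s L n m).const_mul _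
    · exact measurable_const
  have hXm : ∀ L, Measurable (X L) := fun L =>
    Finset.measurable_sum _ fun s _ => Finset.measurable_sum _ fun n _ =>
      Finset.measurable_sum _ fun m _ => hterm s L n m
  -- The sum has `2 * L ^ 2` terms, whence the exponent `k + 2`; at distance `L ^ η` the
  -- localization bound is a stretched exponential in `L ^ (η * ξ)`.
  have hsum : Summable fun L : ℕ =>
      2 * C * ((L : ℝ) ^ (k + 2) * Real.exp (-(c * (L : ℝ) ^ (η * ξ)))) :=
    (summable_pow_mul_exp_neg_rpow (k + 2) (mul_pos hη hξ) hcpos).mul_left _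
  have htermle : ∀ s (L : ℕ), ∀ n ∈ Finset.Icc 1 L, ∀ m ∈ Finset.Icc 1 L, ∫⁻ ω,
      (if ⌈(L : ℝ) ^ η⌉₊ ≤ natTorusDist L n m then (L : ℝ≥0∞) ^ k * Q s L n m ω else 0) ∂P ≤
      (L : ℝ≥0∞) ^ k * ENNReal.ofReal (C * Real.exp (-(c * (L : ℝ) ^ (η * ξ)))) := by
    intro s L n hn m hm
    split_ifs with h
    · obtain ⟨hn1, hn2⟩ := Finset.mem_Icc.1 hn
      obtain ⟨hm1, hm2⟩ := Finset.mem_Icc.1 hm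
      rw [lintegral_const_mul _ (hQm s L n m)]
      gcongr
      refine (hbd s L n m hn1 hn2 hm1 hm2).trans (ENNReal.ofReal_le_ofReal ?_)
      gcongr
      rw [Real.rpow_mul (Nat.cast_nonneg L), div_eq_mul_inv, mul_comm c]
      gcongr
      rw [torusDist_eq_natTorusDist hn2 hm2]
      exact Nat.ceil_le.1 h
    · simp
  have hbound : ∀ L, ∫⁻ ω, X L ω ∂P ≤ ENNReal.ofReal
      (2 * C * ((L : ℝ) ^ (k + 2) * Real.exp (-(c * (L : ℝ) ^ (η * ξ))))) := by
    intro L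
    calc ∫⁻ ω, X L ω ∂P = ∑ s : ℤˣ, ∑ n ∈ Finset.Icc 1 L, ∑ m ∈ Finset.Icc 1 L, ∫⁻ ω,
          (if ⌈(L : ℝ) ^ η⌉₊ ≤ natTorusDist L n m then (L : ℝ≥0∞) ^ k * Q s L n m ω else 0) ∂P := by
          simp only [hX]
          rw [lintegral_finsetSum _ fun s _ => Finset.measurable_sum _ fun n _ =>
            Finset.measurable_sum _ fun m _ => hterm s L n m]
          refine Finset.sum_congr rfl fun s _ => ?_
          rw [lintegral_finsetSum _ fun n _ => Finset.measurable_sum _ fun m _ => hterm s L n m]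
          refine Finset.sum_congr rfl fun n _ => ?_
          rw [lintegral_finsetSum _ fun m _ => hterm s L n m]
      _ ≤ ∑ _s : ℤˣ, ∑ _n ∈ Finset.Icc 1 L, ∑ _m ∈ Finset.Icc 1 L,
          (L : ℝ≥0∞) ^ k * ENNReal.ofReal (C * Real.exp (-(c * (L : ℝ) ^ (η * ξ)))) := by
          gcongr with s _ n hn m hm
          exact htermle s L n hn m hm
      _ = 2 * ((L : ℝ≥0∞) ^ (k + 2) *
          ENNReal.ofReal (C * Real.exp (-(c * (L : ℝ) ^ (η * ξ))))) := by
          simp only [Finset.sum_const, Finset.card_univ, Fintype.card_units_int, Nat.card_Icc,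
            Nat.add_sub_cancel, nsmul_eq_mul]
          push_cast
          ring
      _ = _ := by
          rw [mul_assoc, mul_left_comm C, ENNReal.ofReal_mul (p := 2) (by positivity),
            ENNReal.ofReal_mul (p := (L : ℝ) ^ (k + 2)) (by positivity),
            ENNReal.ofReal_pow (by positivity)]
          simp
  filter_upwards [ae_eventually_le_one hXm hsum hbound] with ω hω
  filter_upwards [hω] with L hL s n hn m hm hnm
  refine le_trans ?_ hL
  refine le_trans ?_ (Finset.single_le_sum (f := fun s => ∑ n ∈ Finset.Icc 1 L,
    ∑ m ∈ Finset.Icc 1 L, (if ⌈(L : ℝ) ^ η⌉₊ ≤ natTorusDist L n m then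
      (L : ℝ≥0∞) ^ k * Q s L n m ω else 0)) (fun _ _ => zero_le) (Finset.mem_univ s))
  refine le_trans ?_ (Finset.single_le_sum (f := fun n =>
    ∑ m ∈ Finset.Icc 1 L, (if ⌈(L : ℝ) ^ η⌉₊ ≤ natTorusDist L n m then
      (L : ℝ≥0∞) ^ k * Q s L n m ω else 0)) (fun _ _ => zero_le) hn)
  refine le_trans ?_ (Finset.single_le_sum (f := fun m =>
    (if ⌈(L : ℝ) ^ η⌉₊ ≤ natTorusDist L n m then
      (L : ℝ≥0∞) ^ k * Q s L n m ω else 0)) (fun _ _ => zero_le) hm)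
  simp only [if_pos hnm]
  exact le_rfl

end AlmostSure

/-! ### From the correlator bounds to the absence of condensation. -/

/-- For large `L`, the correlator bounds yield a bound of order `L ^ (η + q)` on the norm of the
reduced density matrix of an eigenstate. -/
theorem IsEigenbasis.kernelNorm_reducedDensity_le {V : ℝ → ℝ} {L : ℕ} {s : ℤˣ} {E : ℕ → ℝ}
    {f : ℕ → ℝ → ℂ} (h : IsEigenbasis V L s E f) (hf : ∀ j, Measurable (f j)) {J : Set ℝ}
    (hL : 1 ≤ L) {η q : ℝ} (hη : 0 < η) (hq : 0 < q) (hq1 : q ≤ 1)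
    (hdiag : ∀ n ∈ Finset.Icc 1 L, correlator J E f n n ≤ ENNReal.ofReal ((L : ℝ) ^ q))
    (hfar : ∀ n ∈ Finset.Icc 1 L, ∀ m ∈ Finset.Icc 1 L, ⌈(L : ℝ) ^ η⌉₊ ≤ natTorusDist L n m →
      L ^ 11 * correlator J E f n m ≤ 1)
    {N : ℕ} {sel : Fin N → ℕ} (hsel : Function.Injective sel) (hJ : ∀ a, E (sel a) ∈ J) :
    kernelNorm L (reducedDensity L (bosonState fun a => f (sel a))) ≤
      ENNReal.ofReal (72 * (L : ℝ) ^ (η + q)) := by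
  have hL' : (1 : ℝ) ≤ L := by exact_mod_cast hL
  have hLpos : (0 : ℝ) < L := by linarith
  have hLη : 1 ≤ (L : ℝ) ^ η := Real.one_le_rpow hL' hη.le
  have hLq : 1 ≤ (L : ℝ) ^ q := Real.one_le_rpow hL' hq.le
  have hLq1 : (L : ℝ) ^ q ≤ L := by
    simpa using Real.rpow_le_rpow_of_exponent_le hL' hq1
  have hδ : ((((L : ℝ≥0) ^ 11)⁻¹ : ℝ≥0) : ℝ≥0∞) = ENNReal.ofReal (((L : ℝ) ^ 11)⁻¹) := by
    rw [ENNReal.ofReal, Real.toNNReal_of_nonneg (by positivity)]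
    rfl
  have hmain := (h.isOrthonormalOn hf hsel).kernelNorm_reducedDensity_le
    (D := ⌈(L : ℝ) ^ η⌉₊) (δ := ((L : ℝ≥0) ^ 11)⁻¹) (ρ := ENNReal.ofReal ((L : ℝ) ^ q))
    (Nat.one_le_ceil_iff.2 (by positivity))
    (fun a i hi j hj hij => by
      have h1 : cellNorm (f (sel a)) i * cellNorm (f (sel a)) j ≤ correlator J E f i j :=
        (Finset.single_le_sum (f := fun a => cellNorm (f (sel a)) i * cellNorm (f (sel a)) j)
          (fun _ _ => zero_le) (Finset.mem_univ a)).trans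
          (sum_cellNorm_mul_le_correlator hsel hJ i j)
      have h2 := hfar i hi j hj hij
      have h3 : (L : ℝ≥0∞) ^ 11 ≠ 0 := by positivity
      rw [ENNReal.coe_inv (by positivity)]
      push_cast
      rw [ENNReal.le_inv_iff_mul_le, mul_comm]
      exact (mul_le_mul_right h1 _).trans h2)
    (fun n hn => by
      simp only [sq]
      exact (sum_cellNorm_mul_le_correlator hsel hJ n n).trans (hdiag n hn))
  refine hmain.trans ?_
  rw [hδ, ← ENNReal.ofReal_natCast L, ← ENNReal.ofReal_natCast ⌈(L : ℝ) ^ η⌉₊]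
  have hconv : 2 * (17 * ENNReal.ofReal (⌈(L : ℝ) ^ η⌉₊ : ℝ) * ENNReal.ofReal ((L : ℝ) ^ q) +
      ENNReal.ofReal L * ((ENNReal.ofReal L * ENNReal.ofReal ((L : ℝ) ^ q)) ^ 4 *
        (2 * ENNReal.ofReal L ^ 2 * ENNReal.ofReal (((L : ℝ) ^ 11)⁻¹)))) =
      ENNReal.ofReal (2 * (17 * (⌈(L : ℝ) ^ η⌉₊ : ℝ) * (L : ℝ) ^ q +
        L * ((L * (L : ℝ) ^ q) ^ 4 * (2 * (L : ℝ) ^ 2 * ((L : ℝ) ^ 11)⁻¹)))) := by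
    rw [ENNReal.ofReal_mul (by positivity), ENNReal.ofReal_add (by positivity) (by positivity),
      ENNReal.ofReal_mul (by positivity), ENNReal.ofReal_mul (by positivity),
      ENNReal.ofReal_mul (by positivity), ENNReal.ofReal_mul (by positivity),
      ENNReal.ofReal_pow (by positivity), ENNReal.ofReal_mul (by positivity),
      ENNReal.ofReal_mul (by positivity), ENNReal.ofReal_mul (by positivity),
      ENNReal.ofReal_pow (by positivity)]
    simp
  rw [hconv]
  refine ENNReal.ofReal_le_ofReal ?_
  have hceil : (⌈(L : ℝ) ^ η⌉₊ : ℝ) ≤ 2 * (L : ℝ) ^ η := by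
    have := (Nat.ceil_lt_add_one (a := (L : ℝ) ^ η) (by positivity)).le
    linarith
  -- The exponent `11 = 1 + 8 + 2` is what cancels the powers of `L` here, once `q ≤ 1` bounds `L ^
  -- q` by `L`.
  have hfar' : L * ((L * (L : ℝ) ^ q) ^ 4 * (2 * (L : ℝ) ^ 2 * ((L : ℝ) ^ 11)⁻¹)) ≤ 2 := by
    calc L * ((L * (L : ℝ) ^ q) ^ 4 * (2 * (L : ℝ) ^ 2 * ((L : ℝ) ^ 11)⁻¹)) ≤
        L * ((L * (L : ℝ)) ^ 4 * (2 * (L : ℝ) ^ 2 * ((L : ℝ) ^ 11)⁻¹)) := by gcongr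
      _ = 2 := by field_simp
  -- This absorbs the far part into the near one: `2 * (34 + 2) = 72`.
  have h1 : 1 ≤ (L : ℝ) ^ η * (L : ℝ) ^ q := one_le_mul_of_one_le_of_one_le hLη hLq
  rw [Real.rpow_add hLpos]
  calc _ ≤ 2 * (17 * (2 * (L : ℝ) ^ η) * (L : ℝ) ^ q + 2) := by gcongr
    _ ≤ _ := by nlinarith

/-- Ratios to the particle number in the thermodynamic limit. -/
theorem tendsto_div_of_density {a : ℕ → ℝ≥0∞} {N : ℕ → ℕ} {ρ : ℝ} (hρ : 0 < ρ)
    (hN : Tendsto (fun L : ℕ => (N L : ℝ) / L) atTop (𝓝 ρ))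
    (ha : Tendsto (fun L : ℕ => a L / ENNReal.ofReal (L : ℝ)) atTop (𝓝 0)) :
    Tendsto (fun L : ℕ => a L / (N L : ℝ≥0∞)) atTop (𝓝 0) := by
  -- The factor `2 / ρ` comes from `N L ≥ ρ / 2 * L` for large `L`.
  have h1 : Tendsto (fun L : ℕ => ENNReal.ofReal (2 / ρ) * (a L / ENNReal.ofReal (L : ℝ))) atTop
      (𝓝 0) := by
    have := ENNReal.Tendsto.const_mul (a := ENNReal.ofReal (2 / ρ)) ha
      (Or.inr ENNReal.ofReal_ne_top)
    rwa [mul_zero] at this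
  refine tendsto_of_tendsto_of_tendsto_of_le_of_le' tendsto_const_nhds h1
    (Eventually.of_forall fun _ => zero_le) ?_
  filter_upwards [hN.eventually (Ici_mem_nhds (half_lt_self hρ)), eventually_ge_atTop 1] with L hL hL1
  have hLpos : (0 : ℝ) < L := by exact_mod_cast hL1
  rw [le_div_iff₀ hLpos] at hL
  have h2 : 0 < ρ / 2 * L := by positivity
  calc a L / (N L : ℝ≥0∞) = a L / ENNReal.ofReal (N L : ℝ) := by rw [ENNReal.ofReal_natCast]
    _ ≤ a L / ENNReal.ofReal (ρ / 2 * L) := by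
        gcongr
    _ = ENNReal.ofReal (2 / ρ) * (a L / ENNReal.ofReal (L : ℝ)) := by
        rw [div_eq_mul_inv (a L), div_eq_mul_inv (a L), ← ENNReal.ofReal_inv_of_pos h2,
          ← ENNReal.ofReal_inv_of_pos hLpos, mul_left_comm, ← ENNReal.ofReal_mul (by positivity)]
        congr 2
        field_simp

end TonksGirardeau

theorem corollary2 {Ω : Type*} [MeasurableSpace Ω] (P : Measure Ω) [IsProbabilityMeasure P]
    -- the random potential
    (V : Ω → ℝ → ℝ) (hV : Measurable (Function.uncurry V))
    (hVint : ∃ K : ℝ≥0, ∀ n : ℕ, 1 ≤ n →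
      ∫⁻ ω, (∫⁻ x in TonksGirardeau.cell n, ‖V ω x‖ₑ) ∂P ≤ K)
    -- a jointly measurable eigenbasis for every boundary condition `s` and length `L`
    (E : ℤˣ → ℕ → ℕ → Ω → ℝ) (φ : ℤˣ → ℕ → ℕ → Ω → ℝ → ℂ)
    (hE : ∀ s L j, Measurable (E s L j))
    (hφ : ∀ s L j, Measurable (Function.uncurry (φ s L j)))
    (hbasis : ∀ᵐ ω ∂P, ∀ (s : ℤˣ) (L : ℕ), 1 ≤ L →
      TonksGirardeau.IsEigenbasis (V ω) L s (fun j => E s L j ω) (fun j => φ s L j ω))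
    -- localization in the energy regime `J`
    (J : Set ℝ) (hJ : MeasurableSet J)
    (hloc : TonksGirardeau.EigenfunctionCorrelatorLocalization P J E φ)
    -- bounded moments of the local particle number
    (p : ℝ) (hp : 2 < p)
    (hmoment : ∃ K : ℝ≥0, ∀ (s : ℤˣ) (L n : ℕ), 1 ≤ n → n ≤ L →
      ∫⁻ ω, TonksGirardeau.localNumber (V ω) L s J n ^ p ∂P ≤ K)
    -- a sequence of eigenstates: the particle number and the selection of one-particle states
    -- may depend on `L` and on the randomness
    (N : ℕ → Ω → ℕ) (sel : ∀ (L : ℕ) (ω : Ω), Fin (N L ω) → ℕ)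
    (hsel : ∀ᵐ ω ∂P, ∀ L : ℕ, 1 ≤ L → Function.Injective (sel L ω) ∧
      ∀ α, E (TonksGirardeau.boundarySign (N L ω)) L (sel L ω α) ω ∈ J) :
    let γ : ℕ → Ω → ℝ → ℝ → ℂ := fun L ω =>
      TonksGirardeau.reducedDensity L (TonksGirardeau.bosonState fun α : Fin (N L ω) =>
        φ (TonksGirardeau.boundarySign (N L ω)) L (sel L ω α) ω)
    (∀ r : ℝ, 2 / p < r → r ≤ 1 → ∀ᵐ ω ∂P,
      Tendsto (fun L : ℕ => TonksGirardeau.kernelNorm L (γ L ω) / ENNReal.ofReal ((L : ℝ) ^ r))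
        atTop (𝓝 0)) ∧
    -- no condensation in the thermodynamic limit
    (∀ᵐ ω ∂P, ∀ ρ : ℝ, 0 < ρ → Tendsto (fun L : ℕ => (N L ω : ℝ) / L) atTop (𝓝 ρ) →
      Tendsto (fun L : ℕ => TonksGirardeau.kernelNorm L (γ L ω) / (N L ω : ℝ≥0∞))
        atTop (𝓝 0)) := by
  intro γ
  have hfirst : ∀ r : ℝ, 2 / p < r → r ≤ 1 → ∀ᵐ ω ∂P,
      Tendsto (fun L : ℕ => TonksGirardeau.kernelNorm L (γ L ω) / ENNReal.ofReal ((L : ℝ) ^ r))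
        atTop (𝓝 0) := by
    intro r hr hr1
    -- With `2 / p < q < r` and `η = (r - q) / 2` the norm is at most of order `L ^ (η + q)`, which
    -- leaves the decay `L ^ (-(r - q) / 2)` after division by `L ^ r`.
    obtain ⟨q, hpq, hqr⟩ := exists_between hr
    have hq : 0 < q := lt_trans (by positivity) hpq
    have hη : 0 < (r - q) / 2 := by linarith
    filter_upwards [hbasis, hsel,
      TonksGirardeau.ae_eventually_correlator_diag_le hE hφ hbasis hJ (by linarith) hmoment hpq,
      TonksGirardeau.ae_eventually_correlator_far_le hE hφ hJ hloc hη 11] with ω h1 h2 h3 h4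
    have hlim : Tendsto (fun L : ℕ => ENNReal.ofReal (72 * (L : ℝ) ^ (-((r - q) / 2)))) atTop
        (𝓝 0) := by
      rw [← ENNReal.ofReal_zero]
      refine ENNReal.tendsto_ofReal ?_
      have := ((tendsto_rpow_neg_atTop hη).comp tendsto_natCast_atTop_atTop).const_mul (72 : ℝ)
      rwa [mul_zero] at this
    refine tendsto_of_tendsto_of_tendsto_of_le_of_le' tendsto_const_nhds hlim
      (Eventually.of_forall fun _ => zero_le) ?_
    filter_upwards [h3, h4, eventually_ge_atTop 1] with L h3 h4 hL
    have hLpos : (0 : ℝ) < L := by exact_mod_cast hL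
    obtain ⟨hinj, hmem⟩ := h2 L hL
    have hmain := (h1 (TonksGirardeau.boundarySign (N L ω)) L hL).kernelNorm_reducedDensity_le
      (fun j => (hφ _ L j).comp measurable_prodMk_left) hL hη hq (hqr.le.trans hr1)
      (h3 _) (h4 _) hinj hmem
    calc TonksGirardeau.kernelNorm L (γ L ω) / ENNReal.ofReal ((L : ℝ) ^ r) ≤
        ENNReal.ofReal (72 * (L : ℝ) ^ ((r - q) / 2 + q)) / ENNReal.ofReal ((L : ℝ) ^ r) := by
          gcongr
      _ = ENNReal.ofReal (72 * (L : ℝ) ^ (-((r - q) / 2))) := by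
          rw [← ENNReal.ofReal_div_of_pos (by positivity), mul_div_assoc, ← Real.rpow_sub hLpos]
          congr 3
          ring
  refine ⟨hfirst, ?_⟩
  -- The exponent `r = 1` is admissible because `p > 2`. The exceptional null set is that of `r = 1`
  -- and does not depend on `ρ`.
  filter_upwards [hfirst 1 ((div_lt_one (by linarith)).2 hp) le_rfl] with ω hω ρ hρ hN
  simp only [Real.rpow_one] at hω
  exact TonksGirardeau.tendsto_div_of_density hρ hN hω
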